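/- **Corollary 5.1 (Constraints on quasi-isometries).** Let $\tilde M_1,\tilde M_2$ be locally compact CAT(0) spaces, with $\tilde M_2$ complete, and let $\phi:\tilde M_1\to\tilde M_2$ be a (not necessarily continuous) quasi-isometry, or more generally any map for which there are constants $C\ge 1$, $K\ge 0$ with $$\tfrac1C\,d(p,q)-K\le d(\phi(p),\phi(q))\le C\,d(p,q)+K\qquad\text{for all }p,q\in\tilde M_1 .$$ Let $k\ge 1$ and let $\gamma\subset\tilde M_1$ be a $k$-flat, i.e. the image of an isometric embedding of Euclidean $\mathbb R^k$. Let $\mathrm{Cone}(\tilde M_1)$ be an asymptotic cone of $\tilde M_1$, formed with respect to any non-principal ultrafilter $\omega$ on $\mathbb N$, any scaling sequence $\lambda_n\in(0,\infty)$ with $\omega\text{-}\lim\lambda_n=\infty$ and any base point $*$: its points are the sequences $(x_n)$ in $\tilde M_1$ with $\omega\text{-}\lim d(x_n,*)/\lambda_n<\infty$, where sequences at distance $0$ are identified for the distance $d_\omega((x_n),(y_n))=\omega\text{-}\lim d(x_n,y_n)/\lambda_n$. Let $\gamma_\omega\subset\mathrm{Cone}(\tilde M_1)$ be the set of points represented by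 sequences in $\gamma$. Assume that $\gamma_\omega$ bounds a bi-Lipschitz $(k+1)$-dimensional half-flat, i.e. there is a bi-Lipschitz embedding $\mathbb R^k\times[0,\infty)\to\mathrm{Cone}(\tilde M_1)$ mapping $\mathbb R^k\times\{0\}$ onto $\gamma_\omega$. Then at least one of the following holds: 1. (Non-periodicity) every $k$-flat $\eta\subset\tilde M_2$ at finite Hausdorff distance from $\phi(\gamma)$ has non-compact quotient $\eta/\mathrm{Stab}_G(\eta)$, where $G=\mathrm{Isom}(\tilde M_2)$ and $\mathrm{Stab}_G(\eta)=\{g\in G: g(\eta)=\eta\}$; or 2. (Bounding) every $k$-flat $\eta\subset\tilde M_2$ at finite Hausdorff distance from $\phi(\gamma)$ bounds a $(k+1)$-dimensional half-flat, i.e. there is an isometric embedding $\mathbb R^k\times[0,\infty)\to\tilde M_2$ mapping $\mathbb R^k\times\{0\}$ onto $\eta$. -/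

import Mathlib

open scoped NNReal ENNReal Topology

noncomputable section

/-- The curve `c`, restricted to `[0, dist x y]`, is a unit speed geodesic from `x` to `y`. -/
def IsGeodesicFromTo {X : Type*} [MetricSpace X] (c : ℝ → X) (x y : X) : Prop :=
  c 0 = x ∧ c (dist x y) = y ∧
    ∀ s ∈ Set.Icc 0 (dist x y), ∀ t ∈ Set.Icc 0 (dist x y), dist (c s) (c t) = |s - t|

/-- CAT(0) spaces: geodesic metric spaces all of whose geodesic triangles are at least as thin as
their comparison triangles in the Euclidean plane. Any two sides of a triangle share a vertex,
which is called `x` below; `x' y' z'` is a comparison triangle, and `p'`, `q'` are the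
comparison points of `c s`, `d t`. -/
structure IsCAT0Space (X : Type*) [MetricSpace X] : Prop where
  exists_geodesic : ∀ x y : X, ∃ c : ℝ → X, IsGeodesicFromTo c x y
  comparison : ∀ (x y z : X) (c d : ℝ → X), IsGeodesicFromTo c x y → IsGeodesicFromTo d x z →
    ∀ x' y' z' : EuclideanSpace ℝ (Fin 2),
      dist x' y' = dist x y → dist x' z' = dist x z → dist y' z' = dist y z →
    ∀ s ∈ Set.Icc 0 (dist x y), ∀ t ∈ Set.Icc 0 (dist x z),
    ∀ p' ∈ segment ℝ x' y', ∀ q' ∈ segment ℝ x' z', dist x' p' = s → dist x' q' = t →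
      dist (c s) (d t) ≤ dist p' q'

/-- A `k`-flat: an isometrically embedded copy of Euclidean `ℝ^k`. -/
def IsKFlat {X : Type*} [MetricSpace X] (k : ℕ) (A : Set X) : Prop :=
  ∃ f : EuclideanSpace ℝ (Fin k) → X, Isometry f ∧ Set.range f = A

/-- The Euclidean half-space `ℝ^k × [0, ∞)` of dimension `k + 1`, with the `ℓ²` product metric. -/
abbrev HalfSpace (k : ℕ) : Type := WithLp 2 (EuclideanSpace ℝ (Fin k) × ℝ≥0)

/-- The boundary `ℝ^k × {0}` of the half-space. -/
def halfSpaceBoundary (k : ℕ) : Set (HalfSpace k) := {p | p.snd = 0}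

/-- The set `A` (a `k`-flat) bounds a `(k+1)`-dimensional half-flat: there is an isometric
embedding of `ℝ^k × [0, ∞)` which maps the boundary `ℝ^k × {0}` onto `A`. -/
def BoundsHalfFlat {X : Type*} [MetricSpace X] (k : ℕ) (A : Set X) : Prop :=
  ∃ f : HalfSpace k → X, Isometry f ∧ f '' halfSpaceBoundary k = A

/-- The set `A` (a `k`-flat) bounds a bi-Lipschitz `(k+1)`-dimensional half-flat: there is a
bi-Lipschitz embedding of `ℝ^k × [0, ∞)` which maps the boundary `ℝ^k × {0}` onto `A`. -/
def BoundsBiLipschitzHalfFlat {X : Type*} [MetricSpace X] (k : ℕ) (A : Set X) : Prop :=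
  ∃ f : HalfSpace k → X, (∃ K : ℝ≥0, LipschitzWith K f) ∧ (∃ K : ℝ≥0, AntilipschitzWith K f) ∧
    f '' halfSpaceBoundary k = A

/-- `(C, K)`-quasi-isometric maps. -/
def IsQuasiIsometricMap {X Y : Type*} [MetricSpace X] [MetricSpace Y] (C K : ℝ) (φ : X → Y) :
    Prop :=
  1 ≤ C ∧ 0 ≤ K ∧ ∀ p q : X,
    1 / C * dist p q - K ≤ dist (φ p) (φ q) ∧ dist (φ p) (φ q) ≤ C * dist p q + K

/-- Two subsets are at bounded distance from each other if their Hausdorff distance is finite. -/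
def AtBoundedDistance {X : Type*} [MetricSpace X] (A B : Set X) : Prop :=
  Metric.hausdorffEDist A B ≠ ⊤

/-- The stabilizer, in the full isometry group of `X`, of a subset `A`. -/
def isomStabilizer {X : Type*} [MetricSpace X] (A : Set X) : Subgroup (X ≃ᵢ X) where
  carrier := {g | g '' A = A}
  mul_mem' := by
    intro g h hg hh
    simp only [Set.mem_ofPred_eq] at *
    rw [IsometryEquiv.coe_mul, Set.image_comp, hh, hg]
  one_mem' := by simp
  inv_mem' := by
    intro g hg
    simp only [Set.mem_ofPred_eq] at *
    conv_lhs => rw [← hg]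
    rw [← Set.image_comp, ← IsometryEquiv.coe_mul, inv_mul_cancel]
    simp

/-- The orbit equivalence relation on `A` of the action of the stabilizer of `A`. -/
def stabilizerOrbitRel {X : Type*} [MetricSpace X] (A : Set X) : Setoid A where
  r x y := ∃ g ∈ isomStabilizer A, g (x : X) = y
  iseqv :=
    { refl := fun x => ⟨1, one_mem _, rfl⟩
      symm := by
        rintro x y ⟨g, hg, h⟩
        refine ⟨g⁻¹, inv_mem hg, ?_⟩
        rw [← h, ← IsometryEquiv.mul_apply, inv_mul_cancel]
        rfl
      trans := by
        rintro x y z ⟨g, hg, h⟩ ⟨g', hg', h'⟩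
        refine ⟨g' * g, mul_mem hg' hg, ?_⟩
        rw [IsometryEquiv.mul_apply, h, h'] }

/-- The quotient of `A` by its stabilizer in `Isom(X)`, with the quotient topology. -/
abbrev StabilizerQuotient {X : Type*} [MetricSpace X] (A : Set X) : Type _ :=
  Quotient (stabilizerOrbitRel A)

/-- The choices, besides a base point, that go into an asymptotic cone: a non-principal ultrafilter
`ω` on `ℕ`, and scaling factors `scale n ∈ (0, ∞)` whose `ω`-limit is `∞`. -/
structure ConeScaling where
  ω : Ultrafilter ℕ
  nonprincipal : ∀ s : Set ℕ, s.Finite → s ∉ ω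
  scale : ℕ → ℝ
  scale_pos : ∀ n, 0 < scale n
  scale_lim : Filter.Tendsto scale ω Filter.atTop

/-- The `ω`-limit in `[0, ∞]` of `d(x_n, y_n) / scale n`. -/
def coneEDist {X : Type*} [MetricSpace X] (S : ConeScaling) (x y : ℕ → X) : ℝ≥0∞ :=
  (S.ω.map fun n => edist (x n) (y n) / ENNReal.ofReal (S.scale n)).lim

theorem tendsto_coneEDist {X : Type*} [MetricSpace X] (S : ConeScaling) (x y : ℕ → X) :
    Filter.Tendsto (fun n => edist (x n) (y n) / ENNReal.ofReal (S.scale n)) S.ω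
      (𝓝 (coneEDist S x y)) :=
  Ultrafilter.le_nhds_lim (S.ω.map fun n => edist (x n) (y n) / ENNReal.ofReal (S.scale n))

theorem coneEDist_self {X : Type*} [MetricSpace X] (S : ConeScaling) (x : ℕ → X) :
    coneEDist S x x = 0 := by
  refine tendsto_nhds_unique (tendsto_coneEDist S x x) ?_
  simp

theorem coneEDist_comm {X : Type*} [MetricSpace X] (S : ConeScaling) (x y : ℕ → X) :
    coneEDist S x y = coneEDist S y x := by
  simp only [coneEDist, edist_comm]

theorem coneEDist_triangle {X : Type*} [MetricSpace X] (S : ConeScaling) (x y z : ℕ → X) :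
    coneEDist S x z ≤ coneEDist S x y + coneEDist S y z := by
  refine le_of_tendsto_of_tendsto' (tendsto_coneEDist S x z)
    ((tendsto_coneEDist S x y).add (tendsto_coneEDist S y z)) fun n => ?_
  rw [← ENNReal.add_div]
  exact ENNReal.div_le_div_right (edist_triangle _ _ _) _

/-- The sequences in `X` at finite `coneEDist` from the constant sequence at the base point `b`. -/
def ConeSeq (X : Type*) [MetricSpace X] (S : ConeScaling) (b : X) : Type _ :=
  {x : ℕ → X // coneEDist S x (fun _ => b) < ⊤}

instance coneSeqPseudoMetricSpace (X : Type*) [MetricSpace X] (S : ConeScaling) (b : X) :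
    PseudoMetricSpace (ConeSeq X S b) :=
  letI : PseudoEMetricSpace (ConeSeq X S b) :=
    { edist := fun x y => coneEDist S x.1 y.1
      edist_self := fun x => coneEDist_self S x.1
      edist_comm := fun x y => coneEDist_comm S x.1 y.1
      edist_triangle := fun x y z => coneEDist_triangle S x.1 y.1 z.1 }
  PseudoEMetricSpace.toPseudoMetricSpace fun x y => by
    refine ne_of_lt (lt_of_le_of_lt (coneEDist_triangle S x.1 (fun _ => b) y.1) ?_)
    rw [coneEDist_comm S (fun _ => b) y.1]
    exact ENNReal.add_lt_top.2 ⟨x.2, y.2⟩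

/-- The asymptotic cone of `X` with base point `b`: the metric space obtained from the sequences at
finite distance from the base sequence by identifying sequences at distance zero. -/
abbrev MetricCone (X : Type*) [MetricSpace X] (S : ConeScaling) (b : X) : Type _ :=
  SeparationQuotient (ConeSeq X S b)

/-- The subset `A_ω` of the asymptotic cone: the points represented by sequences in `A`. -/
def coneOfSubset {X : Type*} [MetricSpace X] (S : ConeScaling) (b : X) (A : Set X) :
    Set (MetricCone X S b) :=
  {p | ∃ x : ConeSeq X S b, (∀ n, x.1 n ∈ A) ∧ SeparationQuotient.mk x = p}

end

/-!
Suppose that some flat `η₀` at finite Hausdorff distance from `φ '' γ` is periodic, i.e. has a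
cocompact stabilizer, and let `f₀` parametrize it. Every flat `η` at finite Hausdorff distance from
`φ '' γ` has to be shown to bound a half-flat.

The map `φ` carries the bi-Lipschitz half-flat to the asymptotic cone of the target, where it bounds
the limit `J` of the rescaled flat `f₀` (`coneFlat`). Its slice at height one, reparametrized by
`J`, is a Lipschitz map `Q` that stays at bounded distance from `J` and avoids `J`. The nearest-point
projection of `Q` to `J` is therefore a Lipschitz self-map of `ℝ^k` at bounded distance from the
identity, and such a map has an invertible derivative somewhere
(`exists_differentiableAt_det_fderiv_ne_zero`, a degree argument by change of variables). By the
quadrilateral inequality, at such a place all directions of `J` make a right angle with the segment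
to the value of `Q` (`exists_forall_exists_dist_le_add`). By convexity of distance functions this
descends from the cone to the target: there are points arbitrarily far from `η₀` whose distance
function exceeds its value at the centre of an arbitrarily large ball of `η₀` by at most `1` on that
ball (`exists_dist_le_add_one_of_coneFlat`).

The stabilizer of `η₀` moves the centres of these balls into a bounded set. The normalized distance
functions of the translated points converge to a horofunction, which is bounded above on `η₀`, hence
also on `η`. It is convex, so it is constant on `η`, and its gradient rays from the points of `η`
sweep out a half-flat (`IsCAT0Space.boundsHalfFlat`). Here limits of rays exist because the
target is proper, by the Hopf–Rinow theorem (`properSpace_of_exists_geodesic`).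

All CAT(0) geometry enters through two consequences of the comparison axiom, the Bruhat–Tits
inequality and Reshetnyak's quadrilateral inequality. Both survive in the cone.
-/

/-! ### Lipschitz maps at bounded distance from the identity -/

section BoundedDisplacement

open MeasureTheory Metric Set Filter Module

/-- Lagrange interpolation as an extrapolation formula: the value at `1` of a real polynomial of
degree at most `n` is a fixed linear combination of its values at `n + 1` nodes in `(0, a]`. -/
theorem exists_extrapolation_weights (n : ℕ) {a : ℝ} (ha : 0 < a) :
    ∃ v w : ℕ → ℝ, (∀ i, 0 < v i ∧ v i ≤ a) ∧ ∀ p : Polynomial ℝ, p.natDegree ≤ n →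
      p.eval 1 = ∑ i ∈ Finset.range (n + 1), w i * p.eval (v i) := by
  let v : ℕ → ℝ := fun i => a / (i + 1)
  refine ⟨v, fun i => (Lagrange.basis (Finset.range (n + 1)) v i).eval 1, fun i => ⟨by positivity,
    div_le_self ha.le (by simp)⟩, fun p hp => ?_⟩
  have hinj : Set.InjOn v (Finset.range (n + 1)) := by
    intro i _ j _ hij
    have h : a / ((i : ℝ) + 1) = a / (j + 1) := hij
    field_simp at h
    exact_mod_cast (by linarith : (i : ℝ) = j)
  have hdeg : p.degree < (Finset.range (n + 1)).card := by
    rw [Finset.card_range]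
    exact lt_of_le_of_lt Polynomial.degree_le_natDegree (by exact_mod_cast Nat.lt_succ_of_le hp)
  conv_lhs => rw [Lagrange.eq_interpolate hinj hdeg, Lagrange.interpolate_apply]
  rw [Polynomial.eval_finsetSum]
  refine Finset.sum_congr rfl fun i _ => ?_
  rw [Polynomial.eval_mul, Polynomial.eval_C, mul_comm]

variable {E : Type*} [NormedAddCommGroup E] [NormedSpace ℝ E]

theorem exists_forall_norm_lt_det_pos :
    ∃ δ > 0, ∀ B : E →L[ℝ] E, ‖B‖ < δ → 0 < (1 + B).det := by
  have hc : Continuous fun B : E →L[ℝ] E => (1 + B).det :=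
    ContinuousLinearMap.continuous_det.comp (continuous_const.add continuous_id)
  have h0 : (0 : ℝ) < (1 + (0 : E →L[ℝ] E)).det := by
    have : ((1 : E →L[ℝ] E)).det = 1 := LinearMap.det_id
    simp [this]
  obtain ⟨δ, hδ, h⟩ := Metric.eventually_nhds_iff.1 (hc.continuousAt.eventually (lt_mem_nhds h0))
  exact ⟨δ, hδ, fun B hB => h (by simpa using hB)⟩

theorem approximatesLinearOn_add_smul {f : E → E} {L : ℝ≥0} (hf : LipschitzWith L f) {s : ℝ≥0}
    (t : Set E) : ApproximatesLinearOn (fun x => x + (s : ℝ) • f x)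
      (ContinuousLinearEquiv.refl ℝ E : E →L[ℝ] E) t (s * L) := by
  intro x _ y _
  have h : x + (s : ℝ) • f x - (y + (s : ℝ) • f y)
      - (ContinuousLinearEquiv.refl ℝ E : E →L[ℝ] E) (x - y) = (s : ℝ) • (f x - f y) := by
    simp only [ContinuousLinearEquiv.coe_coe, ContinuousLinearEquiv.coe_refl', id_eq, smul_sub]
    abel
  rw [h, norm_smul, NNReal.coe_mul, mul_assoc, Real.norm_of_nonneg s.coe_nonneg]
  exact mul_le_mul_of_nonneg_left (by simpa [dist_eq_norm] using hf.dist_le_mul x y) s.2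

variable [FiniteDimensional ℝ E]

theorem exists_polynomial_det_one_add_smul (A : E →L[ℝ] E) :
    ∃ p : Polynomial ℝ, p.natDegree ≤ finrank ℝ E ∧
      ∀ s : ℝ, p.eval s = (1 + s • A : E →L[ℝ] E).det := by
  let b := finBasis ℝ E
  let M := LinearMap.toMatrix b b (A : E →ₗ[ℝ] E)
  refine ⟨Matrix.det ((Polynomial.X : Polynomial ℝ) • M.map Polynomial.C
    + (1 : Matrix (Fin (finrank ℝ E)) (Fin (finrank ℝ E)) ℝ).map Polynomial.C), ?_, fun s => ?_⟩
  · simpa using Polynomial.natDegree_det_X_add_C_le M 1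
  · rw [← Polynomial.coe_evalRingHom, RingHom.map_det, ContinuousLinearMap.det,
      ← LinearMap.det_toMatrix b]
    have h1 : ((1 + s • A : E →L[ℝ] E) : E →ₗ[ℝ] E) = LinearMap.id + s • (A : E →ₗ[ℝ] E) := rfl
    rw [h1, (LinearMap.toMatrix b b).map_add, (LinearMap.toMatrix b b).map_smul,
      LinearMap.toMatrix_id]
    congr 1
    ext i j
    by_cases hij : i = j <;> simp [M, hij] <;> ring

theorem bijective_add_smul {f : E → E} {L : ℝ≥0} (hf : LipschitzWith L f) {s : ℝ≥0}
    (hs : s * L < 1) : Function.Bijective fun x => x + (s : ℝ) • f x := by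
  have hc : Subsingleton E ∨ s * L < ‖((ContinuousLinearEquiv.refl ℝ E).symm : E →L[ℝ] E)‖₊⁻¹ := by
    rcases subsingleton_or_nontrivial E with h | h
    · exact Or.inl h
    · right
      have : ‖((ContinuousLinearEquiv.refl ℝ E).symm : E →L[ℝ] E)‖₊ = 1 :=
        ContinuousLinearMap.nnnorm_id
      rwa [this, inv_one]
  exact ((approximatesLinearOn_add_smul hf univ).toHomeomorph _ hc).bijective

variable [MeasurableSpace E] [BorelSpace E] (μ : Measure E) [μ.IsAddHaarMeasure]

/-- Change of variables for the small perturbation `x ↦ x + s f x` of the identity. -/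
theorem setIntegral_det_one_add_smul_fderiv {f : E → E} {L : ℝ≥0} (hf : LipschitzWith L f)
    {s : ℝ≥0} (hs : s * L < 1) {D : Set E} (hDm : MeasurableSet D) 
    (hfin : μ ((fun x => x + (s : ℝ) • f x) '' D) ≠ ∞)
    (hD : ∀ x ∈ D, DifferentiableAt ℝ f x)
    (hpos : ∀ x ∈ D, 0 < (1 + (s : ℝ) • fderiv ℝ f x : E →L[ℝ] E).det) :
    IntegrableOn (fun x => (1 + (s : ℝ) • fderiv ℝ f x : E →L[ℝ] E).det) D μ ∧
      ∫ x in D, (1 + (s : ℝ) • fderiv ℝ f x : E →L[ℝ] E).det ∂μ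
        = μ.real ((fun x => x + (s : ℝ) • f x) '' D) := by
  have hder : ∀ x ∈ D, HasFDerivWithinAt (fun x => x + (s : ℝ) • f x)
      (1 + (s : ℝ) • fderiv ℝ f x : E →L[ℝ] E) D x := fun x hx =>
    ((hasFDerivAt_id x).add ((hD x hx).hasFDerivAt.const_smul (s : ℝ))).hasFDerivWithinAt
  have hinj : InjOn (fun x => x + (s : ℝ) • f x) D := (bijective_add_smul hf hs).injective.injOn
  have h1 := integrableOn_image_iff_integrableOn_abs_det_fderiv_smul μ hDm hder hinj
    (fun _ => (1 : ℝ))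
  have h2 := integral_image_eq_integral_abs_det_fderiv_smul μ hDm hder hinj (fun _ => (1 : ℝ))
  have habs : EqOn (fun x => |(1 + (s : ℝ) • fderiv ℝ f x : E →L[ℝ] E).det| • (1 : ℝ))
      (fun x => (1 + (s : ℝ) • fderiv ℝ f x : E →L[ℝ] E).det) D := fun x hx => by
    simp [abs_of_pos (hpos x hx)]
  refine ⟨(integrableOn_congr_fun habs hDm).1 (h1.1 (integrableOn_const hfin)), ?_⟩
  rw [← setIntegral_congr_fun hDm habs, ← h2]
  simp

/-- A Lipschitz self-map of `ℝ^n` at bounded distance from the identity has an invertible derivative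
somewhere. If `f` is the displacement, `∫ det (1 + s Df)` over a large ball is close to the volume
of the ball for small `s`; it is polynomial in `s`, so the same is true for `s = 1`. -/
theorem exists_differentiableAt_det_fderiv_ne_zero {Ψ : E → E} {K : ℝ≥0} (hΨ : LipschitzWith K Ψ)
    {c : ℝ} (hc : ∀ u, dist (Ψ u) u ≤ c) :
    ∃ u, DifferentiableAt ℝ Ψ u ∧ (fderiv ℝ Ψ u).det ≠ 0 := by
  by_contra! hcon
  let μ : Measure E := Measure.addHaar
  have hc0 : 0 ≤ c := dist_nonneg.trans (hc 0)
  set f : E → E := fun x => Ψ x - x with hf_def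
  set L : ℝ≥0 := K + 1 with hL_def
  have hf : LipschitzWith L f := hΨ.sub LipschitzWith.id
  have hfc : ∀ x, ‖f x‖ ≤ c := fun x => by simpa [hf_def, dist_eq_norm] using hc x
  set D : Set E := {x | DifferentiableAt ℝ f x} with hD_def
  have hDm : MeasurableSet D := measurableSet_of_differentiableAt ℝ f
  have hDnull : μ Dᶜ = 0 := hf.ae_differentiableAt
  have hdet0 : ∀ x ∈ D, (1 + (1 : ℝ) • fderiv ℝ f x : E →L[ℝ] E).det = 0 := by
    intro x hx
    have h1 : HasFDerivAt Ψ (1 + (1 : ℝ) • fderiv ℝ f x : E →L[ℝ] E) x := by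
      have := (hasFDerivAt_id x).add (DifferentiableAt.hasFDerivAt hx)
      have h2 : (id + f) = Ψ := by ext y; simp [hf_def]
      rw [h2] at this
      simpa using! this
    have := hcon x h1.differentiableAt
    rwa [h1.fderiv] at this
  obtain ⟨δ, hδ, hδdet⟩ := exists_forall_norm_lt_det_pos (E := E)
  have hmeas2 : ∀ᶠ ε : ℝ≥0 in 𝓝[>] 0, ∀ (t : Set E) (g : E → E),
      ApproximatesLinearOn g (ContinuousLinearEquiv.refl ℝ E : E →L[ℝ] E) t ε →
        μ (g '' t) ≤ (2 : ℝ≥0) * μ t := by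
    refine addHaar_image_le_mul_of_det_lt μ _ ?_
    have : (ContinuousLinearEquiv.refl ℝ E : E →L[ℝ] E).det = 1 := LinearMap.det_id
    rw [this]; norm_num
  obtain ⟨ε, hεprop, hε0⟩ := (hmeas2.and self_mem_nhdsWithin).exists
  have hε0' : (0 : ℝ) < ε := hε0
  -- for `s ≤ a` the map `x ↦ x + s • f x` is bijective, has positive Jacobian determinant, and does
  -- not increase measure by more than the factor `2`
  set a : ℝ := min (min (δ / 2) ε) (1 / 2) / (L + 1) with ha_def
  have hL1 : (0 : ℝ) < L + 1 := by positivity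
  have ha : 0 < a := by positivity
  obtain ⟨v, w, hv, hw⟩ := exists_extrapolation_weights (finrank ℝ E) ha
  have haL : a * (L + 1) = min (min (δ / 2) ε) (1 / 2) := by rw [ha_def]; field_simp
  have hnode : ∀ i, v i * L < δ ∧ v i * L ≤ ε ∧ v i * L < 1 ∧ v i ≤ 1 := by
    intro i
    have h1 : v i * (L + 1) ≤ a * (L + 1) := mul_le_mul_of_nonneg_right (hv i).2 hL1.le
    rw [haL] at h1
    have h2 := h1.trans (min_le_left _ _)
    have h3 := h1.trans (min_le_right _ _)
    have h4 := h2.trans (min_le_left _ _)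
    have h5 := h2.trans (min_le_right _ _)
    have h6 := (hv i).1
    have h7 : 0 ≤ v i * L := by positivity
    refine ⟨?_, ?_, ?_, ?_⟩ <;> nlinarith
  let s : ℕ → ℝ≥0 := fun i => ⟨v i, (hv i).1.le⟩
  have hs1 : ∀ i, s i * L < 1 := fun i => by
    rw [← NNReal.coe_lt_coe]; push_cast; exact (hnode i).2.2.1
  have hpos : ∀ i, ∀ x, 0 < (1 + (s i : ℝ) • fderiv ℝ f x : E →L[ℝ] E).det := by
    intro i x
    refine hδdet _ ?_
    rw [norm_smul, Real.norm_of_nonneg (s i).coe_nonneg]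
    refine lt_of_le_of_lt ?_ (hnode i).1
    exact mul_le_mul_of_nonneg_left (norm_fderiv_le_of_lipschitz ℝ hf) (hv i).1.le
  have hub : ∀ i R, (fun x => x + (s i : ℝ) • f x) '' (closedBall 0 R) ⊆ closedBall 0 (R + c) := by
    rintro i R _ ⟨x, hx, rfl⟩
    rw [mem_closedBall_zero_iff] at hx ⊢
    refine (norm_add_le _ _).trans (add_le_add hx ?_)
    rw [norm_smul, Real.norm_of_nonneg (s i).coe_nonneg]
    have h1 : (s i : ℝ) ≤ 1 := (hnode i).2.2.2
    nlinarith [hfc x, norm_nonneg (f x), (s i).coe_nonneg]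
  have hlb : ∀ i R, closedBall 0 (R - c) ⊆ (fun x => x + (s i : ℝ) • f x) '' (closedBall 0 R) := by
    intro i R y hy
    obtain ⟨x, rfl⟩ := (bijective_add_smul hf (hs1 i)).surjective y
    refine ⟨x, ?_, rfl⟩
    rw [mem_closedBall_zero_iff] at hy ⊢
    have h1 : (s i : ℝ) ≤ 1 := (hnode i).2.2.2
    have h2 : ‖(s i : ℝ) • f x‖ ≤ c := by
      rw [norm_smul, Real.norm_of_nonneg (s i).coe_nonneg]
      nlinarith [hfc x, norm_nonneg (f x), (s i).coe_nonneg]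
    have h3 := norm_sub_le (x + (s i : ℝ) • f x) ((s i : ℝ) • f x)
    rw [add_sub_cancel_right] at h3
    linarith
  -- the volume of the image of a large ball, up to a null set
  let V : ℕ → ℝ → ℝ := fun i R => μ.real ((fun x => x + (s i : ℝ) • f x) '' (closedBall 0 R ∩ D))
  have hfinite : ∀ i R, μ ((fun x => x + (s i : ℝ) • f x) '' (closedBall 0 R ∩ D)) ≠ ∞ := fun i R =>
    ((measure_mono ((image_mono inter_subset_left).trans (hub i R))).trans_lt
      measure_closedBall_lt_top).ne
  have hVle : ∀ i R, V i R ≤ μ.real (closedBall 0 (R + c)) := fun i R =>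
    measureReal_mono ((image_mono inter_subset_left).trans (hub i R)) measure_closedBall_lt_top.ne
  have hVge : ∀ i R, μ.real (closedBall 0 (R - c)) ≤ V i R := by
    intro i R
    have hnull : μ ((fun x => x + (s i : ℝ) • f x) '' Dᶜ) = 0 := by
      have := hεprop Dᶜ _ ((approximatesLinearOn_add_smul hf (s := s i) Dᶜ).mono_num (by
        rw [← NNReal.coe_le_coe]; push_cast; exact (hnode i).2.1))
      simpa [hDnull] using this
    refine ENNReal.toReal_mono (hfinite i R) ?_
    calc μ (closedBall 0 (R - c))
        ≤ μ ((fun x => x + (s i : ℝ) • f x) '' (closedBall 0 R ∩ D)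
            ∪ (fun x => x + (s i : ℝ) • f x) '' Dᶜ) := by
          refine measure_mono ((hlb i R).trans ?_)
          rw [← image_union]
          refine image_mono fun x hx => ?_
          by_cases hxD : x ∈ D
          · exact Or.inl ⟨hx, hxD⟩
          · exact Or.inr hxD
      _ ≤ _ := measure_union_le _ _
      _ = _ := by rw [hnull, add_zero]
  have hzero : ∀ R, ∑ i ∈ Finset.range (finrank ℝ E + 1), w i * V i R = 0 := by
    intro R
    have hI := fun i => setIntegral_det_one_add_smul_fderiv μ hf (hs1 i)
      (measurableSet_closedBall.inter hDm) (hfinite i R) (fun x hx => hx.2) (fun x _ => hpos i x)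
    have h1 : ∫ x in closedBall 0 R ∩ D, ∑ i ∈ Finset.range (finrank ℝ E + 1),
        w i * (1 + (s i : ℝ) • fderiv ℝ f x : E →L[ℝ] E).det ∂μ = 0 := by
      refine setIntegral_eq_zero_of_forall_eq_zero fun x hx => ?_
      obtain ⟨p, hp, hpe⟩ := exists_polynomial_det_one_add_smul (fderiv ℝ f x)
      have := hw p hp
      rw [hpe, hdet0 x hx.2] at this
      rw [this]
      exact Finset.sum_congr rfl fun i _ => by rw [hpe]; rfl
    rw [integral_finsetSum _ fun i _ => (hI i).1.const_mul _] at h1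
    rw [← h1]
    refine Finset.sum_congr rfl fun i _ => ?_
    rw [integral_const_mul, (hI i).2]
  -- divide by the volume of the ball and let its radius tend to infinity
  have hball : ∀ r, 0 ≤ r → μ.real (closedBall 0 r) = r ^ finrank ℝ E * μ.real (closedBall 0 1) := by
    intro r hr
    rw [measureReal_def, Measure.addHaar_closedBall' μ _ hr, ENNReal.toReal_mul,
      ENNReal.toReal_ofReal (by positivity), measureReal_def]
  have hunit : 0 < μ.real (closedBall (0 : E) 1) :=
    ENNReal.toReal_pos (measure_closedBall_pos μ _ one_pos).ne' measure_closedBall_lt_top.ne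
  have hlim : ∀ i, Tendsto (fun R => V i R / μ.real (closedBall 0 R)) atTop (𝓝 1) := by
    intro i
    have hl : ∀ b : ℝ, Tendsto (fun R : ℝ => ((R + b) / R) ^ finrank ℝ E) atTop (𝓝 1) := by
      intro b
      have h1 : Tendsto (fun R : ℝ => 1 + b / R) atTop (𝓝 (1 + 0)) :=
        tendsto_const_nhds.add (tendsto_const_nhds.div_atTop tendsto_id)
      have h2 := h1.pow (finrank ℝ E)
      rw [add_zero, one_pow] at h2
      refine h2.congr' ?_
      filter_upwards [eventually_gt_atTop 0] with R hR
      congr 1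
      field_simp
    refine tendsto_of_tendsto_of_tendsto_of_le_of_le' (hl (-c)) (hl c) ?_ ?_
    · filter_upwards [eventually_gt_atTop c] with R hR
      have h1 := hVge i R
      have hR0 : 0 < R := hc0.trans_lt hR
      rw [hball _ (by linarith)] at h1
      rw [hball _ hR0.le, le_div_iff₀ (by positivity), div_pow]
      refine le_trans (le_of_eq ?_) h1
      field_simp
      ring
    · filter_upwards [eventually_gt_atTop 0] with R hR
      have h1 := hVle i R
      rw [hball _ (by linarith)] at h1
      rw [hball _ hR.le, div_le_iff₀ (by positivity), div_pow]
      refine h1.trans (le_of_eq ?_)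
      field_simp
  have hsum : Tendsto (fun R => ∑ i ∈ Finset.range (finrank ℝ E + 1),
      w i * (V i R / μ.real (closedBall 0 R))) atTop
      (𝓝 (∑ i ∈ Finset.range (finrank ℝ E + 1), w i * 1)) :=
    tendsto_finsetSum _ fun i _ => (hlim i).const_mul _
  have hone : ∑ i ∈ Finset.range (finrank ℝ E + 1), w i * 1 = 1 := by
    have := hw 1 (by simp)
    simpa using this.symm
  rw [hone] at hsum
  have hz : (fun R => ∑ i ∈ Finset.range (finrank ℝ E + 1),
      w i * (V i R / μ.real (closedBall 0 R))) = fun _ => 0 := by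
    ext R
    simp_rw [← mul_div_assoc]
    rw [← Finset.sum_div, hzero, zero_div]
  rw [hz] at hsum
  exact zero_ne_one (tendsto_nhds_unique tendsto_const_nhds hsum)

end BoundedDisplacement

/-! ### Inequalities in CAT(0) spaces -/

section CAT0

open Set

/-- The comparison triangle in the plane, with one vertex at the origin. -/
theorem exists_comparison_triangle {a b c : ℝ} (ha : 0 < a) (hb : 0 ≤ b) (hc : 0 ≤ c)
    (hab : a ≤ b + c) (hba : b ≤ a + c) (hcab : c ≤ a + b) :
    ∃ y z : EuclideanSpace ℝ (Fin 2), ‖y‖ = a ∧ ‖z‖ = b ∧ dist y z = c := by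
  set u := (a ^ 2 + b ^ 2 - c ^ 2) / (2 * a) with hu
  have hua : 2 * a * u = a ^ 2 + b ^ 2 - c ^ 2 := by rw [hu]; field_simp
  have hub : u ^ 2 ≤ b ^ 2 := by
    refine sq_le_sq' ?_ ?_
    · have : 2 * a * (-b) ≤ 2 * a * u := by nlinarith
      exact le_of_mul_le_mul_left this (by positivity)
    · have : 2 * a * u ≤ 2 * a * b := by nlinarith
      exact le_of_mul_le_mul_left this (by positivity)
  have hsq : √(b ^ 2 - u ^ 2) ^ 2 = b ^ 2 - u ^ 2 := Real.sq_sqrt (by linarith)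
  refine ⟨!₂[a, 0], !₂[u, √(b ^ 2 - u ^ 2)], ?_, ?_, ?_⟩
  · rw [EuclideanSpace.norm_eq, Fin.sum_univ_two]
    simp [Real.sqrt_sq ha.le]
  · rw [EuclideanSpace.norm_eq, Fin.sum_univ_two]
    simp only [Real.norm_eq_abs, sq_abs]
    simp [hsq, Real.sqrt_sq hb]
  · rw [EuclideanSpace.dist_eq, Fin.sum_univ_two]
    simp only [Real.dist_eq, sq_abs]
    simp only [Matrix.cons_val_zero, Matrix.cons_val_one, zero_sub, neg_sq, hsq]
    rw [show (a - u) ^ 2 + (b ^ 2 - u ^ 2) = c ^ 2 by linarith, Real.sqrt_sq hc]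

variable {X : Type*} [MetricSpace X]

/-- The Bruhat–Tits inequality. -/
theorem IsCAT0Space.dist_sq_le (hX : IsCAT0Space X) {c : ℝ → X} {x y : X}
    (hc : IsGeodesicFromTo c x y) (z : X) {τ : ℝ} (h0 : 0 ≤ τ) (h1 : τ ≤ 1) :
    dist z (c (τ * dist x y)) ^ 2
      ≤ (1 - τ) * dist z x ^ 2 + τ * dist z y ^ 2 - τ * (1 - τ) * dist x y ^ 2 := by
  rcases eq_or_lt_of_le (dist_nonneg (x := x) (y := y)) with h | h
  · have hxy : x = y := dist_eq_zero.1 h.symm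
    subst hxy
    simp only [dist_self, mul_zero, hc.1]
    apply le_of_eq; ring
  · obtain ⟨d, hd⟩ := hX.exists_geodesic x z
    obtain ⟨y', z', hy', hz', hyz'⟩ := exists_comparison_triangle h (dist_nonneg (x := x) (y := z))
      (dist_nonneg (x := y) (y := z))
      (by linarith [dist_triangle x z y, dist_comm z y]) (dist_triangle x y z)
      (by linarith [dist_triangle y x z, dist_comm y x])
    have key := hX.comparison x y z c d hc hd 0 y' z' (by simpa using hy') (by simpa using hz') hyz'
      (τ * dist x y) ⟨by positivity, by nlinarith⟩ (dist x z) ⟨dist_nonneg, le_rfl⟩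
      (τ • y') ⟨1 - τ, τ, by linarith, h0, by ring, by simp⟩
      z' (right_mem_segment ℝ _ _) (by rw [dist_zero_left, norm_smul, hy', Real.norm_of_nonneg h0])
      (by simpa using hz')
    rw [hd.2.1] at key
    have e1 : dist (τ • y') z' ^ 2
        = (1 - τ) * dist z x ^ 2 + τ * dist z y ^ 2 - τ * (1 - τ) * dist x y ^ 2 := by
      have h2 : dist y z ^ 2 = dist x y ^ 2 - 2 * inner ℝ y' z' + dist x z ^ 2 := by
        rw [← hyz', dist_eq_norm, norm_sub_sq_real, hy', hz']
      rw [dist_eq_norm, norm_sub_sq_real, norm_smul, real_inner_smul_left, hz', mul_pow, hy',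
        Real.norm_of_nonneg h0, dist_comm z x, dist_comm z y, h2]
      ring
    rw [← e1, dist_comm z]
    exact pow_le_pow_left₀ dist_nonneg key 2

/-- Reshetnyak's quadrilateral inequality. -/
theorem IsCAT0Space.quadrilateral (hX : IsCAT0Space X) (x₁ x₂ x₃ x₄ : X) :
    dist x₁ x₃ ^ 2 + dist x₂ x₄ ^ 2
      ≤ dist x₁ x₄ ^ 2 + dist x₂ x₃ ^ 2 + 2 * dist x₁ x₂ * dist x₃ x₄ := by
  rcases eq_or_ne x₁ x₂ with rfl | h12
  · rw [dist_self]; linarith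
  rcases eq_or_ne x₃ x₄ with rfl | h34
  · rw [dist_self]; linarith
  have ha := dist_pos.2 h12
  have hb := dist_pos.2 h34
  set a := dist x₁ x₂
  set b := dist x₃ x₄
  obtain ⟨c, hc⟩ := hX.exists_geodesic x₂ x₄
  -- the point of the diagonal dividing it in the ratio of the two opposite sides
  set τ := a / (a + b) with hτ
  have hτ0 : 0 < τ := by positivity
  have hτ1 : 1 - τ = b / (a + b) := by rw [hτ]; field_simp; ring
  have hτ2 : 0 < 1 - τ := by rw [hτ1]; positivity
  set z := c (τ * dist x₂ x₄)
  have h1 := hX.dist_sq_le hc x₁ hτ0.le (by linarith)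
  have h3 := hX.dist_sq_le hc x₃ hτ0.le (by linarith)
  change dist x₁ z ^ 2 ≤ _ at h1
  change dist x₃ z ^ 2 ≤ _ at h3
  have ht := dist_triangle_right x₁ x₃ z
  have h13 : τ * (1 - τ) * dist x₁ x₃ ^ 2 ≤ (1 - τ) * dist x₁ z ^ 2 + τ * dist x₃ z ^ 2 := by
    have : dist x₁ x₃ ^ 2 ≤ (dist x₁ z + dist x₃ z) ^ 2 := pow_le_pow_left₀ dist_nonneg ht 2
    have h4 := mul_le_mul_of_nonneg_left this (mul_pos hτ0 hτ2).le
    nlinarith [sq_nonneg ((1 - τ) * dist x₁ z - τ * dist x₃ z)]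
  have hsum : τ * (1 - τ) * dist x₁ x₃ ^ 2 ≤ τ * (1 - τ) *
      (dist x₁ x₄ ^ 2 + dist x₂ x₃ ^ 2 - dist x₂ x₄ ^ 2) + (1 - τ) ^ 2 * a ^ 2 + τ ^ 2 * b ^ 2 := by
    rw [dist_comm x₂ x₃]
    change dist x₁ z ^ 2 ≤ (1 - τ) * a ^ 2 + _ - _ at h1
    change dist x₃ z ^ 2 ≤ _ + τ * b ^ 2 - _ at h3
    nlinarith [mul_le_mul_of_nonneg_left h1 hτ2.le, mul_le_mul_of_nonneg_left h3 hτ0.le]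
  have hab : (1 - τ) ^ 2 * a ^ 2 + τ ^ 2 * b ^ 2 = τ * (1 - τ) * (2 * a * b) := by
    rw [hτ1, hτ]; field_simp; ring
  rw [add_assoc, hab, ← mul_add] at hsum
  have := le_of_mul_le_mul_left hsum (mul_pos hτ0 hτ2)
  linarith

/-- The map `J` satisfies the Bruhat–Tits inequality along the line segments of its domain: it
behaves like the parametrization of a flat in a CAT(0) space. Asymptotic cones inherit this from the
rescaled flats, and need not be known to be CAT(0). -/
def BruhatTitsAlong {Z E : Type*} [PseudoMetricSpace Z] [NormedAddCommGroup E] [NormedSpace ℝ E]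
    (J : E → Z) : Prop :=
  ∀ (z : Z) (u v : E) (τ : ℝ), 0 ≤ τ → τ ≤ 1 → dist z (J (AffineMap.lineMap u v τ)) ^ 2
    ≤ (1 - τ) * dist z (J u) ^ 2 + τ * dist z (J v) ^ 2 - τ * (1 - τ) * dist u v ^ 2

variable {E : Type*} [NormedAddCommGroup E] [NormedSpace ℝ E]

theorem Isometry.isGeodesicFromTo {f : E → X} (hf : Isometry f) (u v : E) :
    IsGeodesicFromTo (fun t => f (AffineMap.lineMap u v (t / dist u v))) (f u) (f v) := by
  rcases eq_or_ne u v with rfl | huv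
  · simp [IsGeodesicFromTo]
  have h := dist_pos.2 huv
  refine ⟨by simp, by simp [hf.dist_eq, div_self h.ne'], fun s _ t _ => ?_⟩
  rw [hf.dist_eq, dist_lineMap_lineMap, Real.dist_eq, ← sub_div, abs_div, abs_of_pos h,
    div_mul_cancel₀ _ h.ne']

theorem Isometry.bruhatTitsAlong (hX : IsCAT0Space X) {f : E → X} (hf : Isometry f) :
    BruhatTitsAlong f := by
  intro z u v τ h0 h1
  have h := hX.dist_sq_le (hf.isGeodesicFromTo u v) z h0 h1
  rw [hf.dist_eq] at h
  rcases eq_or_ne u v with rfl | huv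
  · simp; apply le_of_eq; ring
  · rwa [mul_div_cancel_right₀ _ (dist_pos.2 huv).ne'] at h

section

variable {Z : Type*} [PseudoMetricSpace Z] {J : E → Z}

theorem BruhatTitsAlong.convexOn (hJ : BruhatTitsAlong J) (hiso : Isometry J) (z : Z) :
    ConvexOn ℝ univ fun u => dist z (J u) := by
  refine ⟨convex_univ, fun u _ v _ a b ha hb hab => ?_⟩
  obtain rfl : a = 1 - b := by linarith
  have h := hJ z u v b hb (by linarith)
  rw [AffineMap.lineMap_apply_module] at h
  simp only [smul_eq_mul]
  refine abs_le_of_sq_le_sq' ?_ (by positivity) |>.2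
  have h1 : dist (J u) (J v) = dist u v := hiso.dist_eq u v
  have h2 : |dist z (J u) - dist z (J v)| ≤ dist u v := by
    rw [← h1, dist_comm z, dist_comm z]; exact abs_dist_sub_le _ _ _
  have h3 : (dist z (J u) - dist z (J v)) ^ 2 ≤ dist u v ^ 2 :=
    sq_le_sq' (by linarith [abs_le.1 h2]) (abs_le.1 h2).2
  nlinarith [mul_le_mul_of_nonneg_left h3 (mul_nonneg ha hb)]

/-- The angle at a nearest point `J x` of `z` is at least a right angle. -/
theorem BruhatTitsAlong.dist_sq_add_le (hJ : BruhatTitsAlong J) {z : Z} {x : E}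
    (hx : ∀ u, dist z (J x) ≤ dist z (J u)) (u : E) :
    dist z (J x) ^ 2 + dist x u ^ 2 ≤ dist z (J u) ^ 2 := by
  by_contra! hcon
  set a := dist z (J x) ^ 2
  set b := dist z (J u) ^ 2
  set d := dist x u ^ 2
  have hab : a ≤ b := pow_le_pow_left₀ dist_nonneg (hx u) 2
  have hd' : 0 < d := by linarith
  have key : ∀ τ : ℝ, 0 < τ → τ ≤ 1 → (1 - τ) * d ≤ b - a := by
    intro τ h0 h1
    have h := hJ z x u τ h0.le h1
    have h2 : a ≤ dist z (J (AffineMap.lineMap x u τ)) ^ 2 := pow_le_pow_left₀ dist_nonneg (hx _) 2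
    have h3 : τ * ((1 - τ) * d) ≤ τ * (b - a) := by
      change _ ≤ (1 - τ) * a + τ * b - τ * (1 - τ) * d at h
      linarith
    exact le_of_mul_le_mul_left h3 h0
  have h := key ((a + d - b) / (2 * d)) (by apply div_pos <;> linarith)
    (by rw [div_le_one (by linarith)]; linarith)
  have h2 : (a + d - b) / (2 * d) * d = (a + d - b) / 2 := by field_simp
  nlinarith

end

/-- A convex function on a vector space which is bounded above is constant. -/
theorem ConvexOn.eq_of_bddAbove {g : E → ℝ} (hg : ConvexOn ℝ univ g) {C : ℝ} (hC : ∀ u, g u ≤ C)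
    (u v : E) : g u = g v := by
  have key : ∀ u v, g v ≤ g u := by
    intro u v
    have h : ∀ n : ℕ, g v ≤ g u + (C - g u) / (n + 1) := by
      intro n
      have h1 : (0 : ℝ) < n + 1 := by positivity
      have := hg.2 (mem_univ u) (mem_univ (u + ((n : ℝ) + 1) • (v - u)))
        (show (0 : ℝ) ≤ 1 - 1 / (n + 1) by
          rw [sub_nonneg, div_le_one h1]; linarith [n.cast_nonneg (α := ℝ)])
        (show (0 : ℝ) ≤ 1 / (n + 1) by positivity)
        (by ring)
      have e : (1 - 1 / ((n : ℝ) + 1)) • u + (1 / ((n : ℝ) + 1)) • (u + ((n : ℝ) + 1) • (v - u))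
          = v := by
        rw [smul_add, smul_smul, one_div_mul_cancel h1.ne', one_smul, sub_smul, one_smul]
        abel
      rw [e, smul_eq_mul, smul_eq_mul] at this
      have h2 := mul_le_mul_of_nonneg_left (hC (u + ((n : ℝ) + 1) • (v - u)))
        (by positivity : (0 : ℝ) ≤ 1 / (n + 1))
      have h3 : (C - g u) / (n + 1) = 1 / (n + 1) * C - 1 / (n + 1) * g u := by ring
      linarith
    have hlim : Filter.Tendsto (fun n : ℕ => g u + (C - g u) / ((n : ℝ) + 1)) Filter.atTop
        (𝓝 (g u + 0)) := by
      refine tendsto_const_nhds.add (tendsto_const_nhds.div_atTop ?_)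
      exact Filter.tendsto_atTop_add_const_right _ _ tendsto_natCast_atTop_atTop
    rw [add_zero] at hlim
    exact ge_of_tendsto' hlim h
  exact le_antisymm (key v u) (key u v)

/-- The Hopf–Rinow theorem, for geodesic spaces. -/
theorem properSpace_of_exists_geodesic [LocallyCompactSpace X] [CompleteSpace X]
    (hX : ∀ x y : X, ∃ c : ℝ → X, IsGeodesicFromTo c x y) : ProperSpace X := by
  -- a point of a ball is close to a slightly smaller concentric ball
  have hshrink : ∀ (x y : X) (r δ : ℝ), 0 ≤ r → 0 ≤ δ → dist x y ≤ r + δ →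
      ∃ z ∈ Metric.closedBall x r, dist y z ≤ δ := by
    intro x y r δ hr hδ hxy
    obtain ⟨c, hc0, hc1, hc⟩ := hX x y
    rcases le_total (dist x y) r with h | h
    · exact ⟨y, by rwa [Metric.mem_closedBall'], by simpa using hδ⟩
    · refine ⟨c r, ?_, ?_⟩
      · rw [Metric.mem_closedBall', ← hc0, hc 0 ⟨le_rfl, dist_nonneg⟩ r ⟨hr, h⟩]
        simp [abs_of_nonneg hr]
      · rw [← hc1, hc _ ⟨dist_nonneg, le_rfl⟩ r ⟨hr, h⟩, abs_of_nonneg (by linarith)]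
        linarith
  refine ⟨fun x => ?_⟩
  by_contra! hcon
  obtain ⟨R, hR⟩ := hcon
  let S : Set ℝ := {r | 0 ≤ r ∧ ¬ IsCompact (Metric.closedBall x r)}
  have hRS : R ∈ S := by
    refine ⟨?_, hR⟩
    by_contra! h
    exact hR (by rw [Metric.closedBall_eq_empty.2 h]; exact isCompact_empty)
  have hSb : BddBelow S := ⟨0, fun r hr => hr.1⟩
  set ρ := sInf S with hρ
  have hρ0 : 0 ≤ ρ := le_csInf ⟨R, hRS⟩ fun r hr => hr.1
  have hlt : ∀ r < ρ, IsCompact (Metric.closedBall x r) := by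
    intro r hr
    rcases lt_or_ge r 0 with h | h
    · rw [Metric.closedBall_eq_empty.2 h]; exact isCompact_empty
    · by_contra hc
      exact absurd (csInf_le hSb (show r ∈ S from ⟨h, hc⟩)) (not_le.2 hr)
  have hcpt : IsCompact (Metric.closedBall x ρ) := by
    rcases hρ0.eq_or_lt with h | h
    · rw [← h, Metric.closedBall_zero]; exact isCompact_singleton
    refine isCompact_iff_totallyBounded_isComplete.2
      ⟨Metric.totallyBounded_iff.2 fun ε hε => ?_, Metric.isClosed_closedBall.isComplete⟩
    obtain ⟨δ, hδ0, hδε, hδρ⟩ : ∃ δ, 0 < δ ∧ δ < ε ∧ δ ≤ ρ :=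
      ⟨min (ε / 2) ρ, lt_min (by linarith) h, (min_le_left _ _).trans_lt (by linarith),
        min_le_right _ _⟩
    obtain ⟨t, ht, htc⟩ := Metric.totallyBounded_iff.1 (hlt (ρ - δ) (by linarith)).totallyBounded
      (ε - δ) (by linarith)
    refine ⟨t, ht, fun y hy => ?_⟩
    obtain ⟨z, hz, hyz⟩ := hshrink x y (ρ - δ) δ (by linarith) hδ0.le
      (by rw [Metric.mem_closedBall'] at hy; linarith)
    obtain ⟨w, hw, hzw⟩ := mem_iUnion₂.1 (htc hz)
    refine mem_iUnion₂.2 ⟨w, hw, ?_⟩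
    rw [Metric.mem_ball] at hzw ⊢
    linarith [dist_triangle y z w]
  obtain ⟨δ, hδ, hthick⟩ := hcpt.exists_isCompact_cthickening
  have hall : ∀ r < ρ + δ, IsCompact (Metric.closedBall x r) := by
    intro r hr
    refine hthick.of_isClosed_subset Metric.isClosed_closedBall fun y hy => ?_
    obtain ⟨z, hz, hyz⟩ := hshrink x y ρ δ hρ0 hδ.le
      (by rw [Metric.mem_closedBall'] at hy; linarith)
    exact Metric.mem_cthickening_of_dist_le y z δ _ hz hyz
  obtain ⟨r, hrS, hr⟩ := exists_lt_of_csInf_lt ⟨R, hRS⟩ (show sInf S < ρ + δ by linarith)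
  exact hrS.2 (hall r hr)

end CAT0

/-! ### Half-flats from horofunctions that are constant on a flat -/

section HalfFlat

open Set Filter

theorem HalfSpace.dist_eq {k : ℕ} (x y : HalfSpace k) :
    dist x y = √(dist x.fst y.fst ^ 2 + ((x.snd : ℝ) - y.snd) ^ 2) := by
  rw [WithLp.prod_dist_eq_add (by norm_num), Real.sqrt_eq_rpow, NNReal.dist_eq]
  norm_num

theorem Ultrafilter.exists_tendsto_of_eventually_dist_le {X ι : Type*} [PseudoMetricSpace X]
    [ProperSpace X] (U : Ultrafilter ι) {x : ι → X} {o : X} {C : ℝ}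
    (h : ∀ᶠ j in U, dist (x j) o ≤ C) : ∃ l, Tendsto x U (𝓝 l) := by
  obtain ⟨l, -, hl⟩ := (isCompact_closedBall o C).ultrafilter_le_nhds (U.map x)
    (le_principal_iff.2 h)
  exact ⟨l, hl⟩

/-- A sequence going to infinity in a proper CAT(0) space determines, along an ultrafilter, a
horofunction `β`, and from every point `q` a geodesic ray `σ q` on which `β` decreases with unit
speed. -/
theorem IsCAT0Space.exists_horofunction {X : Type*} [MetricSpace X] [ProperSpace X]
    (hX : IsCAT0Space X) {p : ℕ → X} {o : X} (hp : Tendsto (fun j => dist (p j) o) atTop atTop)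
    (U : Ultrafilter ℕ) (hU : (U : Filter ℕ) ≤ atTop) :
    ∃ (β : X → ℝ) (σ : X → ℝ → X),
      (∀ z, Tendsto (fun j => dist (p j) z - dist (p j) o) U (𝓝 (β z))) ∧
      (∀ q h, 0 ≤ h → β (σ q h) = β q - h) ∧
      (∀ q h y, 0 ≤ h → dist (σ q h) y ^ 2 ≤ dist q y ^ 2 + 2 * h * (β y - β q) + h ^ 2) := by
  have hpU : Tendsto (fun j => dist (p j) o) U atTop := hp.mono_left hU
  have hlim : ∀ z, ∃ l, Tendsto (fun j => dist (p j) z - dist (p j) o) U (𝓝 l) := by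
    intro z
    refine U.exists_tendsto_of_eventually_dist_le (o := 0) (C := dist z o) (.of_forall fun j => ?_)
    rw [Real.dist_0_eq_abs, dist_comm (p j), dist_comm (p j)]
    exact abs_dist_sub_le _ _ _
  choose β hβ using hlim
  have hpq : ∀ q, Tendsto (fun j => dist q (p j)) U atTop := by
    intro q
    refine tendsto_atTop_mono (f := fun j => dist (p j) o - dist q o) (fun j => ?_)
      (tendsto_atTop_add_const_right _ _ hpU)
    linarith [dist_triangle_left (p j) o q]
  have hgeo : ∀ q j, ∃ c : ℝ → X, IsGeodesicFromTo c q (p j) := fun q j => hX.exists_geodesic _ _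
  choose c hc using hgeo
  have hcq : ∀ q h, 0 ≤ h → ∀ᶠ j in U, dist (c q j h) q = h ∧
      dist (p j) (c q j h) = dist q (p j) - h := by
    intro q h hh
    filter_upwards [(hpq q).eventually_ge_atTop h] with j hj
    have h1 := (hc q j).2.2 h ⟨hh, hj⟩ 0 ⟨le_rfl, dist_nonneg⟩
    have h2 := (hc q j).2.2 _ ⟨dist_nonneg, le_rfl⟩ h ⟨hh, hj⟩
    rw [(hc q j).1, sub_zero, abs_of_nonneg hh] at h1
    rw [(hc q j).2.1, abs_of_nonneg (by linarith)] at h2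
    exact ⟨h1, h2⟩
  have hσ : ∀ q h, ∃ l, 0 ≤ h → Tendsto (fun j => c q j h) U (𝓝 l) := by
    intro q h
    by_cases hh : 0 ≤ h
    · obtain ⟨l, hl⟩ := U.exists_tendsto_of_eventually_dist_le (x := fun j => c q j h) (o := q)
        ((hcq q h hh).mono fun j hj => hj.1.le)
      exact ⟨l, fun _ => hl⟩
    · exact ⟨q, fun h' => absurd h' hh⟩
  choose σ hσ using hσ
  refine ⟨β, σ, hβ, fun q h hh => ?_, fun q h y hh => ?_⟩
  · have h1 : Tendsto (fun j => dist (p j) (c q j h) - dist (p j) o) U (𝓝 (β q - h)) := by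
      refine ((hβ q).sub_const h).congr' ?_
      filter_upwards [hcq q h hh] with j hj
      rw [hj.2, dist_comm q]
      ring
    have h2 : Tendsto (fun j => dist (p j) (σ q h) - dist (p j) (c q j h)) U (𝓝 0) := by
      have hd : Tendsto (fun j => dist (c q j h) (σ q h)) U (𝓝 0) :=
        tendsto_iff_dist_tendsto_zero.1 (hσ q h hh)
      refine squeeze_zero_norm (fun j => ?_) hd
      rw [Real.norm_eq_abs, dist_comm (p j), dist_comm (p j), dist_comm (c q j h) (σ q h)]
      exact abs_dist_sub_le _ _ _
    have h3 := h2.add h1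
    simp only [sub_add_sub_cancel, zero_add] at h3
    exact tendsto_nhds_unique (hβ _) h3
  · have hdiff : Tendsto (fun j => dist y (p j) - dist q (p j)) U (𝓝 (β y - β q)) := by
      refine ((hβ y).sub (hβ q)).congr fun j => ?_
      rw [dist_comm y, dist_comm q]
      ring
    have hs : Tendsto (fun j => h / dist q (p j)) U (𝓝 0) :=
      tendsto_const_nhds.div_atTop (hpq q)
    have hquot : Tendsto (fun j => (dist y (p j) - dist q (p j)) / dist q (p j)) U (𝓝 0) :=
      hdiff.div_atTop (hpq q)
    have hR : Tendsto (fun j => (1 - h / dist q (p j)) * dist y q ^ 2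
        + h * (dist y (p j) - dist q (p j))
          * (2 + (dist y (p j) - dist q (p j)) / dist q (p j)) + h ^ 2) U
        (𝓝 ((1 - 0) * dist y q ^ 2 + h * (β y - β q) * (2 + 0) + h ^ 2)) :=
      (((hs.const_sub 1).mul_const _).add ((hdiff.const_mul h).mul (hquot.const_add 2))).add_const _
    have hL : Tendsto (fun j => dist (c q j h) y ^ 2) U (𝓝 (dist (σ q h) y ^ 2)) :=
      ((hσ q h hh).dist tendsto_const_nhds).pow 2
    refine (le_of_tendsto_of_tendsto hL hR ?_).trans (le_of_eq ?_)
    · filter_upwards [(hpq q).eventually_ge_atTop h, (hpq q).eventually_gt_atTop 0] with j hj hj0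
      have h1 := hX.dist_sq_le (hc q j) y (τ := h / dist q (p j)) (by positivity)
        (by rwa [div_le_one hj0])
      rw [div_mul_cancel₀ _ hj0.ne'] at h1
      rw [dist_comm _ y]
      refine h1.trans (le_of_eq ?_)
      field_simp
      ring
    · rw [dist_comm y q]; ring

/-- If the functions `d (p j, ·)`, normalized at a base point, are bounded above on a flat for a
sequence `p j` going to infinity, then the flat bounds a half-flat: their limit `β` is convex, so
constant on the flat, and the gradient rays of `β` from the points of the flat fit together. -/
theorem IsCAT0Space.boundsHalfFlat {X : Type*} [MetricSpace X] [ProperSpace X]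
    (hX : IsCAT0Space X) {k : ℕ} {f : EuclideanSpace ℝ (Fin k) → X} (hf : Isometry f)
    {p : ℕ → X} {o : X} (hp : Tendsto (fun j => dist (p j) o) atTop atTop) {C : ℝ}
    (hC : ∀ u, ∀ᶠ j in atTop, dist (p j) (f u) - dist (p j) o ≤ C) :
    BoundsHalfFlat k (range f) := by
  have hU : ((hyperfilter ℕ : Ultrafilter ℕ) : Filter ℕ) ≤ atTop := Nat.hyperfilter_le_atTop
  obtain ⟨β, σ, hβ, hβσ, hstar⟩ := hX.exists_horofunction hp (hyperfilter ℕ) hU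
  have hconv : ConvexOn ℝ univ fun u => β (f u) := by
    refine ⟨convex_univ, fun u _ v _ a b ha hb hab => ?_⟩
    refine le_of_tendsto_of_tendsto' (hβ _) (((hβ (f u)).const_smul a).add
      ((hβ (f v)).const_smul b)) fun j => ?_
    have := ((hf.bruhatTitsAlong hX).convexOn hf (p j)).2 (mem_univ u) (mem_univ v) ha hb hab
    simp only [smul_eq_mul] at this ⊢
    obtain rfl : a = 1 - b := by linarith
    linarith
  have hconst : ∀ u v, β (f u) = β (f v) := hconv.eq_of_bddAbove (C := C) fun u =>
    le_of_tendsto (hβ _) ((hC u).filter_mono hU)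
  have hlip : ∀ y z, β y - β z ≤ dist y z := fun y z =>
    le_of_tendsto' ((hβ y).sub (hβ z)) fun j => by
      linarith [dist_triangle_right (p j) y z, dist_triangle (p j) z y, dist_comm y z]
  -- upper bound for distances, from the comparison with tall thin triangles
  have hup : ∀ u v h h', 0 ≤ h → 0 ≤ h' →
      dist (σ (f u) h) (σ (f v) h') ^ 2 ≤ dist u v ^ 2 + (h - h') ^ 2 := by
    intro u v h h' hh hh'
    have h1 := hstar (f u) h (f v) hh
    have h2 := hstar (f v) h' (σ (f u) h) hh'
    rw [hconst v u, sub_self, mul_zero, add_zero, hf.dist_eq] at h1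
    rw [hβσ _ _ hh, hconst v u, dist_comm, dist_comm (f v)] at h2
    linarith
  have hzero : ∀ u, σ (f u) 0 = f u := by
    intro u
    have := hstar (f u) 0 (f u) le_rfl
    simp only [dist_self] at this
    exact dist_eq_zero.1 (pow_eq_zero_iff two_ne_zero |>.1
      (le_antisymm (by linarith) (sq_nonneg _)))
  -- the points at height `h` lie exactly above their starting points
  have hheight : ∀ u v h h', 0 ≤ h → h ≤ h' → h' - h ≤ dist (σ (f u) h') (σ (f v) h) := by
    intro u v h h' hh hhh
    have := hlip (σ (f v) h) (σ (f u) h')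
    rw [hβσ _ _ hh, hβσ _ _ (hh.trans hhh), hconst v u, dist_comm] at this
    linarith
  have hvert : ∀ u h h', 0 ≤ h → h ≤ h' → dist (σ (f u) h') (σ (f u) h) = h' - h := by
    intro u h h' hh hhh
    refine le_antisymm ?_ (hheight u u h h' hh hhh)
    have := hup u u h' h (hh.trans hhh) hh
    rw [dist_self, zero_pow two_ne_zero, zero_add] at this
    exact (abs_le_of_sq_le_sq' this (by linarith)).2
  -- an isometric horizontal slice has right angles with the rays
  have hobt : ∀ h, 0 ≤ h → Isometry (fun u => σ (f u) h) → ∀ u v h', h ≤ h' →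
      (h' - h) ^ 2 + dist u v ^ 2 ≤ dist (σ (f u) h') (σ (f v) h) ^ 2 := by
    intro h hh hiso u v h' hhh
    have := (hiso.bruhatTitsAlong hX).dist_sq_add_le (z := σ (f u) h') (x := u) (fun w => by
      rw [hvert u h h' hh hhh]
      exact hheight u w h h' hh hhh) v
    rwa [hvert u h h' hh hhh] at this
  have hslice : ∀ h, 0 ≤ h → Isometry (fun u => σ (f u) h) := by
    intro h hh
    refine Isometry.of_dist_eq fun u v => le_antisymm ?_ ?_
    · have := hup u v h h hh hh
      rw [sub_self, zero_pow two_ne_zero, add_zero] at this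
      exact (abs_le_of_sq_le_sq' this dist_nonneg).2
    · rcases eq_or_ne u v with rfl | huv
      · simp
      have h0 : Isometry fun u => σ (f u) 0 := by simpa only [hzero] using hf
      have h1 := hobt 0 le_rfl h0 u v h hh
      have h2 := hobt 0 le_rfl h0 v u h hh
      have h3 := hX.quadrilateral (σ (f u) h) (σ (f v) h) (f v) (f u)
      have h4 := hvert u 0 h le_rfl hh
      have h5 := hvert v 0 h le_rfl hh
      rw [hzero] at h1 h2 h4 h5
      rw [h4, h5, hf.dist_eq, dist_comm v u] at h3
      rw [dist_comm v u] at h2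
      have hd := dist_pos.2 huv
      refine le_of_mul_le_mul_right ?_ hd
      nlinarith
  have hle : ∀ u v h h', 0 ≤ h → h ≤ h' →
      dist (σ (f u) h') (σ (f v) h) = √(dist u v ^ 2 + (h' - h) ^ 2) := by
    intro u v h h' hh hhh
    rw [eq_comm, Real.sqrt_eq_iff_mul_self_eq (by positivity) dist_nonneg, ← sq]
    refine le_antisymm ?_ (hup u v h' h (hh.trans hhh) hh)
    rw [add_comm]
    exact hobt h hh (hslice h hh) u v h' hhh
  refine ⟨fun x => σ (f x.fst) x.snd, Isometry.of_dist_eq fun x y => ?_, ?_⟩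
  · rw [HalfSpace.dist_eq]
    rcases le_total (y.snd : ℝ) x.snd with h | h
    · exact hle _ _ _ _ y.snd.coe_nonneg h
    · rw [dist_comm, hle _ _ _ _ x.snd.coe_nonneg h, dist_comm, ← neg_sub, neg_sq]
  · ext z
    constructor
    · rintro ⟨x, hx, rfl⟩
      have hx' : x.snd = 0 := hx
      refine ⟨x.fst, ?_⟩
      simp only [hx', NNReal.coe_zero, hzero]
    · rintro ⟨u, rfl⟩
      exact ⟨WithLp.toLp 2 (u, 0), rfl, by simp [hzero]⟩

end HalfFlat

/-! ### A point of the cone that sees the flat at right angles in all directions -/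

section RightAngles

open Set Filter

variable {Z E : Type*} [PseudoMetricSpace Z] [NormedAddCommGroup E] [NormedSpace ℝ E]
  [FiniteDimensional ℝ E] {J : E → Z}

theorem Isometry.exists_forall_dist_le (hJ : Isometry J) (z : Z) :
    ∃ x, ∀ u, dist z (J x) ≤ dist z (J u) := by
  refine (continuous_const.dist hJ.continuous).exists_forall_le ?_
  refine tendsto_atTop_mono (f := fun u => ‖u‖ + -dist z (J 0)) (fun u => ?_)
    (tendsto_atTop_add_const_right _ _ (tendsto_norm_cocompact_atTop (E := E)))
  have := dist_triangle_left (J u) (J 0) z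
  rw [hJ.dist_eq, dist_zero_right] at this
  linarith

/-- Let `Q` be a Lipschitz map at bounded distance from the flat `J`, with values off `J`. Then some
value of `Q` is such that all directions of `J` make a right angle with the segment from its
nearest point on `J`: the distance to that value has vanishing derivative there. Such values are
found where the projection of `Q` to `J` has invertible derivative, because the quadrilateral
inequality bounds the distance from a value of `Q` to the projection of a neighbouring one up to
a second order error. -/
theorem exists_forall_exists_dist_le_add (hiso : Isometry J) (hJ : BruhatTitsAlong J)
    (hquad : ∀ (z w : Z) (u v : E), dist z (J v) ^ 2 + dist w (J u) ^ 2
      ≤ dist z (J u) ^ 2 + dist w (J v) ^ 2 + 2 * dist z w * dist u v)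
    {Q : E → Z} {K : ℝ≥0} (hQ : LipschitzWith K Q) {c : ℝ} (hc : ∀ u, dist (Q u) (J u) ≤ c)
    (hpos : ∀ u v, 0 < dist (Q u) (J v)) :
    ∃ u x, ∀ ε > 0, ∃ s > 0, ∀ v : E, ‖v‖ ≤ 1 →
      dist (Q u) (J (x + s • v)) ≤ dist (Q u) (J x) + ε * s := by
  choose π hπ using hiso.exists_forall_dist_le
  have hπ1 : ∀ z w, dist (π z) (π w) ≤ dist z w := by
    intro z w
    have h1 := hJ.dist_sq_add_le (hπ z) (π w)
    have h2 := hJ.dist_sq_add_le (hπ w) (π z)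
    have h3 := hquad z w (π z) (π w)
    rw [dist_comm (π w)] at h2
    rcases (dist_nonneg (x := π z) (y := π w)).eq_or_lt with h | h
    · rw [← h]; exact dist_nonneg
    · refine le_of_mul_le_mul_right ?_ h
      nlinarith
  borelize E
  have hΨ : LipschitzWith K fun u => π (Q u) := LipschitzWith.of_dist_le_mul fun u v =>
    (hπ1 _ _).trans (hQ.dist_le_mul u v)
  obtain ⟨u₀, hdiff, hdet⟩ := exists_differentiableAt_det_fderiv_ne_zero hΨ (c := 2 * c) (by
    intro u
    have h1 := dist_triangle_left (J (π (Q u))) (J u) (Q u)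
    rw [hiso.dist_eq] at h1
    linarith [hπ (Q u) u, hc u])
  set A := (fderiv ℝ (fun u => π (Q u)) u₀) with hA
  let B : E →L[ℝ] E := (ContinuousLinearMap.toContinuousLinearEquivOfDetNeZero A hdet).symm
  have hAB : ∀ v, A (B v) = v := fun v =>
    (ContinuousLinearMap.toContinuousLinearEquivOfDetNeZero A hdet).apply_symm_apply v
  set x := π (Q u₀) with hx
  set r := dist (Q u₀) (J x) with hr
  have hr0 : 0 < r := hpos _ _
  refine ⟨u₀, x, fun ε hε => ?_⟩
  set b := ‖B‖ + 1 with hb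
  have hb0 : 0 < b := by positivity
  obtain ⟨δ, hδ, hder⟩ := Metric.eventually_nhds_iff.1
    (hdiff.hasFDerivAt.isLittleO.def (show 0 < ε / (2 * b) by positivity))
  set a := r * ε / (2 * ((K * b) ^ 2 + 1)) with ha
  have ha0 : 0 < a := by positivity
  set s := min (δ / (2 * b)) a with hs
  have hs0 : 0 < s := by positivity
  refine ⟨s, hs0, fun v hv => ?_⟩
  set u := u₀ + s • B v with hu
  have huu : ‖u - u₀‖ ≤ s * b := by
    rw [hu, add_sub_cancel_left, norm_smul, Real.norm_of_nonneg hs0.le]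
    have := B.le_opNorm v
    refine mul_le_mul_of_nonneg_left ?_ hs0.le
    nlinarith [norm_nonneg B]
  have hsδ : s * b < δ := by
    have : s * b ≤ δ / (2 * b) * b := mul_le_mul_of_nonneg_right (min_le_left _ _) hb0.le
    have h2 : δ / (2 * b) * b = δ / 2 := by field_simp
    linarith
  have h1 : dist (π (Q u)) (x + s • v) ≤ ε / 2 * s := by
    have := hder (y := u) (by rw [dist_eq_norm]; linarith)
    rw [← hA, hu, add_sub_cancel_left, map_smul, hAB, ← hu, sub_sub] at this
    rw [dist_eq_norm]
    refine this.trans ?_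
    rw [hu, add_sub_cancel_left] at huu
    refine (mul_le_mul_of_nonneg_left huu (by positivity)).trans (le_of_eq ?_)
    field_simp
  have h2 : dist (Q u₀) (Q u) ≤ K * (s * b) := by
    refine (hQ.dist_le_mul _ _).trans (mul_le_mul_of_nonneg_left ?_ K.coe_nonneg)
    rwa [dist_comm, dist_eq_norm]
  have h3 : dist (Q u₀) (J (π (Q u))) ≤ r + ε / 2 * s := by
    refine (abs_le_of_sq_le_sq' ?_ (by positivity)).2
    have h4 := hquad (Q u₀) (Q u) x (π (Q u))
    have h5 : dist (Q u) (J (π (Q u))) ^ 2 ≤ dist (Q u) (J x) ^ 2 :=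
      pow_le_pow_left₀ dist_nonneg (hπ _ _) 2
    have h6 : dist x (π (Q u)) ≤ K * (s * b) := (hπ1 _ _).trans h2
    have h7 : dist (Q u₀) (Q u) * dist x (π (Q u)) ≤ (K * (s * b)) * (K * (s * b)) :=
      mul_le_mul h2 h6 dist_nonneg (by positivity)
    have h8 : s * ((K * b) ^ 2 + 1) ≤ r * ε / 2 := by
      have : s * ((K * b) ^ 2 + 1) ≤ a * ((K * b) ^ 2 + 1) :=
        mul_le_mul_of_nonneg_right (min_le_right _ _) (by positivity)
      refine this.trans (le_of_eq ?_)
      rw [ha]; field_simp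
    have h9 := mul_le_mul_of_nonneg_left h8 hs0.le
    rw [← hr] at h4
    nlinarith [sq_nonneg (ε / 2 * s), mul_pos hs0 hs0]
  have h4 := dist_triangle (Q u₀) (J (π (Q u))) (J (x + s • v))
  rw [hiso.dist_eq] at h4
  linarith

end RightAngles

/-! ### Sequences representing points of asymptotic cones -/

section Cone

open Set Filter

variable {X Y : Type*} [MetricSpace X] [MetricSpace Y] {S : ConeScaling} {b : X} {b' : Y}

theorem ConeScaling.eventually_le_scale (S : ConeScaling) (D : ℝ) : ∀ᶠ n in S.ω, D ≤ S.scale n :=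
  S.scale_lim.eventually_ge_atTop D

theorem ConeSeq.tendsto_dist (x y : ConeSeq X S b) :
    Tendsto (fun n => dist (x.1 n) (y.1 n) / S.scale n) S.ω (𝓝 (dist x y)) := by
  have hne : coneEDist S x.1 y.1 ≠ ⊤ := edist_ne_top x y
  have h := (ENNReal.tendsto_toReal hne).comp (tendsto_coneEDist S x.1 y.1)
  refine h.congr fun n => ?_
  simp [ENNReal.toReal_div, edist_dist, ENNReal.toReal_ofReal, (S.scale_pos n).le]

theorem ConeSeq.exists_eventually_dist_le (x y : ConeSeq X S b) :
    ∃ C, ∀ᶠ n in S.ω, dist (x.1 n) (y.1 n) ≤ C * S.scale n := by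
  refine ⟨dist x y + 1, ?_⟩
  filter_upwards [(x.tendsto_dist y).eventually_lt_const (lt_add_one _)] with n hn
  exact ((div_lt_iff₀ (S.scale_pos n)).1 hn).le

theorem coneEDist_lt_top_of_eventually_le {x y : ℕ → X} {C : ℝ}
    (h : ∀ᶠ n in S.ω, dist (x n) (y n) ≤ C * S.scale n) : coneEDist S x y < ⊤ := by
  refine lt_of_le_of_lt (le_of_tendsto (tendsto_coneEDist S x y) ?_) (ENNReal.ofReal_lt_top (r := C))
  filter_upwards [h] with n hn
  rw [edist_dist, ← ENNReal.ofReal_div_of_pos (S.scale_pos n)]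
  exact ENNReal.ofReal_le_ofReal ((div_le_iff₀ (S.scale_pos n)).2 hn)

/-- Coarse inequalities between distances lose their additive constants in the cone. -/
theorem ConeSeq.dist_le_mul_dist {x y : ConeSeq X S b} {x' y' : ConeSeq Y S b'} {A B : ℝ}
    (h : ∀ n, dist (x.1 n) (y.1 n) ≤ A * dist (x'.1 n) (y'.1 n) + B) :
    dist x y ≤ A * dist x' y' := by
  have hB : Tendsto (fun n => B / S.scale n) S.ω (𝓝 0) := tendsto_const_nhds.div_atTop S.scale_lim
  have hlim := ((x'.tendsto_dist y').const_mul A).add hB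
  rw [add_zero] at hlim
  refine le_of_tendsto_of_tendsto' (x.tendsto_dist y) hlim fun n => ?_
  rw [← mul_div_assoc, ← add_div]
  exact div_le_div_of_nonneg_right (h n) (S.scale_pos n).le

/-- The map induced on cones by a quasi-isometric map. -/
def IsQuasiIsometricMap.coneMap {C K : ℝ} {φ : X → Y} (hφ : IsQuasiIsometricMap C K φ)
    (x : ConeSeq X S b) : ConeSeq Y S (φ b) :=
  ⟨fun n => φ (x.1 n), by
    obtain ⟨D, hD⟩ := x.exists_eventually_dist_le ⟨fun _ => b, by simp [coneEDist_self]⟩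
    refine coneEDist_lt_top_of_eventually_le (C := C * D + 1) ?_
    filter_upwards [hD, S.eventually_le_scale K] with n hn hK
    have h1 := (hφ.2.2 (x.1 n) b).2
    have h2 := mul_le_mul_of_nonneg_left hn (zero_le_one.trans hφ.1)
    linarith⟩

theorem IsQuasiIsometricMap.dist_le {C K : ℝ} {φ : X → Y} (hφ : IsQuasiIsometricMap C K φ)
    (p q : X) : dist p q ≤ C * dist (φ p) (φ q) + C * K := by
  have hC : 0 < C := zero_lt_one.trans_le hφ.1
  have h := mul_le_mul_of_nonneg_left (hφ.2.2 p q).1 hC.le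
  have e : C * (1 / C * dist p q - K) = dist p q - C * K := by field_simp
  linarith

theorem IsQuasiIsometricMap.dist_coneMap_le {C K : ℝ} {φ : X → Y} (hφ : IsQuasiIsometricMap C K φ)
    (x y : ConeSeq X S b) : dist (hφ.coneMap x) (hφ.coneMap y) ≤ C * dist x y :=
  ConeSeq.dist_le_mul_dist fun n => (hφ.2.2 (x.1 n) (y.1 n)).2

theorem IsQuasiIsometricMap.le_dist_coneMap {C K : ℝ} {φ : X → Y} (hφ : IsQuasiIsometricMap C K φ)
    (x y : ConeSeq X S b) : dist x y ≤ C * dist (hφ.coneMap x) (hφ.coneMap y) :=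
  ConeSeq.dist_le_mul_dist fun n => hφ.dist_le (x.1 n) (y.1 n)

variable {E : Type*} [NormedAddCommGroup E] [NormedSpace ℝ E]

/-- The flat in the cone which is the limit of the rescalings of the flat `f`. -/
def coneFlat (S : ConeScaling) (b : X) {f : E → X} (hf : Isometry f) (u : E) : ConeSeq X S b :=
  ⟨fun n => f (S.scale n • u), by
    refine coneEDist_lt_top_of_eventually_le (C := ‖u‖ + 1) ?_
    filter_upwards [S.eventually_le_scale (dist (f 0) b)] with n hn
    have h := dist_triangle (f (S.scale n • u)) (f 0) b
    rw [hf.dist_eq, dist_zero_right, norm_smul, Real.norm_of_nonneg (S.scale_pos n).le] at h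
    linarith⟩

theorem isometry_coneFlat (S : ConeScaling) (b : X) {f : E → X} (hf : Isometry f) :
    Isometry (coneFlat S b hf) := by
  refine Isometry.of_dist_eq fun u v => ?_
  refine tendsto_nhds_unique ((coneFlat S b hf u).tendsto_dist (coneFlat S b hf v)) ?_
  refine tendsto_const_nhds.congr fun n => ?_
  have hn := S.scale_pos n
  simp only [coneFlat, hf.dist_eq, dist_smul₀, Real.norm_of_nonneg hn.le]
  field_simp

theorem bruhatTitsAlong_coneFlat (hX : IsCAT0Space X) (S : ConeScaling) (b : X) {f : E → X}
    (hf : Isometry f) : BruhatTitsAlong (coneFlat S b hf) := by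
  intro z u v τ h0 h1
  refine le_of_tendsto_of_tendsto' ((z.tendsto_dist _).pow 2)
    (((((z.tendsto_dist (coneFlat S b hf u)).pow 2).const_mul (1 - τ)).add
      (((z.tendsto_dist (coneFlat S b hf v)).pow 2).const_mul τ)).sub_const _) fun n => ?_
  have hn := S.scale_pos n
  have h := hf.bruhatTitsAlong hX (z.1 n) (S.scale n • u) (S.scale n • v) τ h0 h1
  have e : AffineMap.lineMap (S.scale n • u) (S.scale n • v) τ
      = S.scale n • AffineMap.lineMap u v τ := by
    simp only [AffineMap.lineMap_apply_module, smul_add]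
    rw [smul_comm, smul_comm τ]
  rw [e, dist_smul₀, Real.norm_of_nonneg hn.le] at h
  simp only [coneFlat, div_pow]
  rw [div_le_iff₀ (by positivity)]
  refine h.trans (le_of_eq ?_)
  field_simp

theorem coneFlat_quadrilateral (hX : IsCAT0Space X) (S : ConeScaling) (b : X) {f : E → X}
    (hf : Isometry f) (z w : ConeSeq X S b) (u v : E) :
    dist z (coneFlat S b hf v) ^ 2 + dist w (coneFlat S b hf u) ^ 2
      ≤ dist z (coneFlat S b hf u) ^ 2 + dist w (coneFlat S b hf v) ^ 2
        + 2 * dist z w * dist u v := by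
  rw [← (isometry_coneFlat S b hf).dist_eq u v]
  refine le_of_tendsto_of_tendsto' (((z.tendsto_dist _).pow 2).add ((w.tendsto_dist _).pow 2))
    ((((z.tendsto_dist _).pow 2).add ((w.tendsto_dist _).pow 2)).add
      (((z.tendsto_dist w).const_mul 2).mul
        ((coneFlat S b hf u).tendsto_dist (coneFlat S b hf v)))) fun n => ?_
  have hn := S.scale_pos n
  have h := hX.quadrilateral (z.1 n) (w.1 n) ((coneFlat S b hf v).1 n) ((coneFlat S b hf u).1 n)
  rw [dist_comm ((coneFlat S b hf v).1 n)] at h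
  have h2 := div_le_div_of_nonneg_right h (sq_nonneg (S.scale n))
  refine le_trans (le_of_eq ?_) (h2.trans (le_of_eq ?_)) <;> field_simp

/-- A right angle between the flat and a point of the cone unravels, by convexity of the distance
functions, to points of the space far from the flat whose distance function is almost constant on
large balls of the flat. -/
theorem exists_dist_le_add_one_of_coneFlat [FiniteDimensional ℝ E] (hX : IsCAT0Space X) {f : E → X}
    (hf : Isometry f) {z : ConeSeq X S b} {x : E} (hz : 0 < dist z (coneFlat S b hf x))
    (h : ∀ ε > 0, ∃ s > 0, ∀ v : E, ‖v‖ ≤ 1 →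
      dist z (coneFlat S b hf (x + s • v)) ≤ dist z (coneFlat S b hf x) + ε * s)
    {N : ℝ} (hN : 0 < N) :
    ∃ (p : X) (y : E), N ≤ dist p (f y) ∧ ∀ u, dist u y ≤ N → dist p (f u) ≤ dist p (f y) + 1 := by
  set r := dist z (coneFlat S b hf x)
  set ε := 1 / (4 * N) with hε
  have hε0 : 0 < ε := by positivity
  obtain ⟨s, hs, hsv⟩ := h ε hε0
  obtain ⟨t, htsub, htfin, ht⟩ := (isCompact_closedBall (0 : E) 1).finite_cover_balls hε0
  have hev : ∀ᶠ n in S.ω, ∀ w ∈ t,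
      dist (z.1 n) (f (S.scale n • (x + s • w))) / S.scale n < r + 2 * ε * s := by
    refine (eventually_all_finite htfin).2 fun w hw => ?_
    refine (z.tendsto_dist (coneFlat S b hf (x + s • w))).eventually_lt_const ?_
    have := hsv w (by simpa using htsub hw)
    nlinarith
  have hlow : ∀ᶠ n in S.ω, max (r - ε * s) (r / 2) < dist (z.1 n) (f (S.scale n • x)) / S.scale n :=
    (z.tendsto_dist (coneFlat S b hf x)).eventually_const_lt
      (max_lt (by nlinarith) (by linarith))
  obtain ⟨n, hn1, hn2, hn3, hn4⟩ := (hev.and (hlow.and ((S.eventually_le_scale (N / s)).and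
    (S.eventually_le_scale (2 * N / r))))).exists
  have hl := S.scale_pos n
  set l := S.scale n
  have h1 : (r - ε * s) * l < dist (z.1 n) (f (l • x)) :=
    (lt_div_iff₀ hl).1 ((le_max_left _ _).trans_lt hn2)
  have h2 : r / 2 * l < dist (z.1 n) (f (l • x)) :=
    (lt_div_iff₀ hl).1 ((le_max_right _ _).trans_lt hn2)
  rw [div_le_iff₀ hs] at hn3
  rw [div_le_iff₀ hz] at hn4
  refine ⟨z.1 n, l • x, by linarith, fun u hu => ?_⟩
  -- write `u` as a point of the segment from `l • x` to a point at distance at most `l * s`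
  set v := (1 / N) • (u - l • x) with hv
  have hvn : ‖v‖ ≤ 1 := by
    rw [hv, norm_smul, Real.norm_of_nonneg (by positivity), ← dist_eq_norm, one_div_mul_eq_div]
    exact (div_le_one hN).2 hu
  obtain ⟨w, hw, hvw⟩ := mem_iUnion₂.1 (ht (mem_closedBall_zero_iff.2 hvn))
  have h3 : dist (z.1 n) (f (l • (x + s • w))) < (r + 2 * ε * s) * l := (div_lt_iff₀ hl).1 (hn1 w hw)
  have h4 : dist (z.1 n) (f (l • (x + s • v))) ≤ dist (z.1 n) (f (l • x)) + 4 * ε * (l * s) := by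
    have h5 := dist_triangle_right (z.1 n) (f (l • (x + s • v))) (f (l • (x + s • w)))
    rw [hf.dist_eq, dist_smul₀, dist_add_left, dist_smul₀, Real.norm_of_nonneg hl.le,
      Real.norm_of_nonneg hs.le] at h5
    have h6 : l * (s * dist v w) ≤ l * (s * ε) := by
      have := (Metric.mem_ball.1 hvw).le
      gcongr
    nlinarith
  have hls : 0 < l * s := by positivity
  have hconv := ((hf.bruhatTitsAlong hX).convexOn hf (z.1 n)).2 (mem_univ (l • x))
    (mem_univ (l • (x + s • v))) (show 0 ≤ 1 - N / (l * s) by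
      rw [sub_nonneg, div_le_one hls]; exact hn3) (show 0 ≤ N / (l * s) by positivity) (by ring)
  have e : (1 - N / (l * s)) • (l • x) + (N / (l * s)) • (l • (x + s • v)) = u := by
    rw [hv, smul_add l, smul_add (N / (l * s)), ← add_assoc, ← add_smul, sub_add_cancel, one_smul,
      smul_smul, smul_smul, smul_smul]
    have : N / (l * s) * (l * (s * (1 / N))) = 1 := by field_simp
    rw [← mul_assoc, ← mul_assoc] at this
    rw [this, one_smul, add_sub_cancel]
  simp only [smul_eq_mul, e] at hconv
  have h7 := mul_le_mul_of_nonneg_left h4 (show 0 ≤ N / (l * s) by positivity)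
  have h8 : N / (l * s) * (4 * ε * (l * s)) = 1 := by rw [hε]; field_simp
  linarith

end Cone

/-! ### Periodic flats and quasi-isometries -/

section QuasiIsometries

open Set Filter

theorem exists_dist_le_of_compactSpace_stabilizerQuotient {X : Type*} [MetricSpace X] (A : Set X)
    [CompactSpace (StabilizerQuotient A)] (o : X) :
    ∃ D : ℝ, ∀ y ∈ A, ∃ g ∈ isomStabilizer A, dist (g y) o ≤ D := by
  let π : A → StabilizerQuotient A := Quotient.mk _
  -- the sets of orbits meeting the ball of radius `n` form an increasing open cover
  let U : ℕ → Set (StabilizerQuotient A) := fun n => π '' {y | dist (y : X) o < n}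
  have hU : ∀ n, IsOpen (U n) := by
    intro n
    refine isOpen_coinduced.2 ?_
    rw [isOpen_iff_mem_nhds]
    rintro y ⟨z, hz, hzy⟩
    obtain ⟨g, hg, hgz⟩ : ∃ g ∈ isomStabilizer A, g (y : X) = z := Quotient.exact hzy.symm
    have hopen : IsOpen {w : A | dist (g (w : X)) o < n} :=
      isOpen_lt ((g.continuous.comp continuous_subtype_val).dist continuous_const) continuous_const
    refine mem_of_superset (hopen.mem_nhds (by simpa [hgz] using hz)) fun w hw => ?_
    have hgA : g '' A = A := hg
    have hgw : g (w : X) ∈ A := hgA.subset (mem_image_of_mem _ w.2)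
    exact ⟨⟨g w, hgw⟩, hw, (Quotient.sound ⟨g, hg, rfl⟩ : π w = π ⟨g w, hgw⟩).symm⟩
  obtain ⟨n, hn⟩ := isCompact_univ.elim_directed_cover U hU (fun q _ => by
      obtain ⟨y, rfl⟩ := Quotient.exists_rep q
      obtain ⟨n, hn⟩ := exists_nat_gt (dist (y : X) o)
      exact mem_iUnion.2 ⟨n, y, hn, rfl⟩)
    (Monotone.directed_le fun m n hmn => image_mono fun y (hy : dist (y : X) o < m) =>
      hy.trans_le (by exact_mod_cast hmn))
  refine ⟨n, fun y hy => ?_⟩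
  obtain ⟨z, hz, hzy⟩ := hn (mem_univ (π ⟨y, hy⟩))
  obtain ⟨g, hg, hgz⟩ : ∃ g ∈ isomStabilizer A, g y = z := Quotient.exact hzy.symm
  exact ⟨g, hg, by rw [hgz]; exact le_of_lt hz⟩

variable {M₁ M₂ : Type*} [MetricSpace M₁] [MetricSpace M₂]

/-- A bi-Lipschitz half-flat bounded by `γ` in the cone is carried by the quasi-isometric map to the
cone of the target. Its slice at height one is a Lipschitz map at bounded distance from the
limit of the rescaled flat `f`, and avoids that limit. -/
theorem exists_dist_le_add_one_of_boundsBiLipschitzHalfFlat (hM₂ : IsCAT0Space M₂) {φ : M₁ → M₂}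
    {C K : ℝ} (hφ : IsQuasiIsometricMap C K φ) {k : ℕ} {γ : Set M₁} {S : ConeScaling} {b : M₁}
    (hF : BoundsBiLipschitzHalfFlat k (coneOfSubset S b γ))
    {f : EuclideanSpace ℝ (Fin k) → M₂} (hf : Isometry f) {D : ℝ}
    (hD : ∀ u, ∃ a ∈ γ, dist (f u) (φ a) ≤ D) {N : ℝ} (hN : 0 < N) :
    ∃ (p : M₂) (y : EuclideanSpace ℝ (Fin k)), N ≤ dist p (f y) ∧
      ∀ u, dist u y ≤ N → dist p (f u) ≤ dist p (f y) + 1 := by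
  obtain ⟨F, ⟨L, hL⟩, ⟨A, hA⟩, hFb⟩ := hF
  have hC0 : 0 ≤ C := zero_le_one.trans hφ.1
  let J := coneFlat S (φ b) hf
  choose rep hrep using fun y => SeparationQuotient.surjective_mk (F y)
  have hrepd : ∀ y y', dist (rep y) (rep y') = dist (F y) (F y') := fun y y' => by
    rw [← hrep, ← hrep, SeparationQuotient.dist_mk]
  -- every point of the limit flat is the image of a point of `F '' halfSpaceBoundary k`
  have hlift : ∀ u, ∃ y ∈ halfSpaceBoundary k, dist (hφ.coneMap (rep y)) (J u) = 0 := by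
    intro u
    choose a haγ ha using fun n => hD (S.scale n • u)
    obtain ⟨B, hB⟩ := (J u).exists_eventually_dist_le ⟨fun _ => φ b, by simp [coneEDist_self]⟩
    have haS : coneEDist S a (fun _ => b) < ⊤ := by
      refine coneEDist_lt_top_of_eventually_le (C := C * (B + 1) + 1) ?_
      filter_upwards [hB, S.eventually_le_scale D, S.eventually_le_scale (C * K)] with n h1 h2 h3
      have h4 := hφ.dist_le (a n) b
      have h5 : dist (f (S.scale n • u)) (φ b) ≤ B * S.scale n := h1
      have h6 := dist_triangle_left (φ (a n)) (φ b) (f (S.scale n • u))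
      have h7 : C * dist (φ (a n)) (φ b) ≤ C * ((B + 1) * S.scale n) := by
        refine mul_le_mul_of_nonneg_left ?_ hC0
        linarith [ha n]
      linarith
    let a' : ConeSeq M₁ S b := ⟨a, haS⟩
    have hmem : SeparationQuotient.mk a' ∈ coneOfSubset S b γ := ⟨a', haγ, rfl⟩
    rw [← hFb] at hmem
    obtain ⟨y, hy, hya⟩ := hmem
    refine ⟨y, hy, le_antisymm ?_ dist_nonneg⟩
    have h1 : dist (rep y) a' = 0 := by
      rw [← SeparationQuotient.dist_mk, hrep, hya, dist_self]
    have h2 := hφ.dist_coneMap_le (rep y) a'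
    have h3 : dist (hφ.coneMap a') (J u) ≤ 0 * dist (J u) (J u) :=
      ConeSeq.dist_le_mul_dist (B := D) fun n => by
        rw [dist_comm, zero_mul, zero_add]; exact ha n
    have h4 := dist_triangle (hφ.coneMap (rep y)) (hφ.coneMap a') (J u)
    rw [h1, mul_zero] at h2
    linarith
  choose Y hYb hYJ using hlift
  let up : HalfSpace k → HalfSpace k := fun y => WithLp.toLp 2 (y.fst, 1)
  have hup : ∀ u v, dist (up (Y u)) (up (Y v)) = dist (Y u) (Y v) := by
    intro u v
    have h1 : (Y u).snd = 0 := hYb u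
    have h2 : (Y v).snd = 0 := hYb v
    rw [HalfSpace.dist_eq, HalfSpace.dist_eq, h1, h2]
    simp [up]
  have hup1 : ∀ u, dist (up (Y u)) (Y u) = 1 := by
    intro u
    have h1 : (Y u).snd = 0 := hYb u
    rw [HalfSpace.dist_eq, h1]
    simp [up]
  let Q : EuclideanSpace ℝ (Fin k) → ConeSeq M₂ S (φ b) := fun u => hφ.coneMap (rep (up (Y u)))
  have hiso := isometry_coneFlat S (φ b) hf
  have hYd : ∀ u v, dist (hφ.coneMap (rep (Y u))) (hφ.coneMap (rep (Y v))) = dist u v := by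
    intro u v
    rw [← hiso.dist_eq u v]
    have h1 := dist_triangle4_left (hφ.coneMap (rep (Y u))) (hφ.coneMap (rep (Y v))) (J u) (J v)
    have h2 := dist_triangle4_right (hφ.coneMap (rep (Y u))) (hφ.coneMap (rep (Y v))) (J u) (J v)
    rw [hYJ, hYJ] at h1 h2
    change dist (hφ.coneMap (rep (Y u))) (hφ.coneMap (rep (Y v))) = dist (J u) (J v)
    exact le_antisymm (by linarith) (by linarith)
  have hQ : LipschitzWith (C.toNNReal * L * (A * C.toNNReal)) Q := by
    refine LipschitzWith.of_dist_le_mul fun u v => ?_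
    have h1 := hφ.dist_coneMap_le (rep (up (Y u))) (rep (up (Y v)))
    have h2 := hL.dist_le_mul (up (Y u)) (up (Y v))
    have h3 := hA.le_mul_dist (Y u) (Y v)
    have h4 := hφ.le_dist_coneMap (rep (Y u)) (rep (Y v))
    rw [hYd, hrepd] at h4
    rw [hrepd] at h1
    rw [hup] at h2
    push_cast
    rw [Real.coe_toNNReal _ hC0]
    calc dist (Q u) (Q v) ≤ C * (L * (A * (C * dist u v))) := by
          refine h1.trans (mul_le_mul_of_nonneg_left (h2.trans ?_) hC0)
          exact mul_le_mul_of_nonneg_left (h3.trans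
            (mul_le_mul_of_nonneg_left h4 A.coe_nonneg)) L.coe_nonneg
      _ = _ := by ring
  have hQc : ∀ u, dist (Q u) (J u) ≤ C * L := by
    intro u
    have h1 := hφ.dist_coneMap_le (rep (up (Y u))) (rep (Y u))
    have h2 := hL.dist_le_mul (up (Y u)) (Y u)
    rw [hup1, mul_one] at h2
    rw [hrepd] at h1
    have h3 := dist_triangle (Q u) (hφ.coneMap (rep (Y u))) (J u)
    rw [hYJ, add_zero] at h3
    exact h3.trans (h1.trans (mul_le_mul_of_nonneg_left h2 hC0))
  have hQpos : ∀ u v, 0 < dist (Q u) (J v) := by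
    intro u v
    refine lt_of_le_of_ne dist_nonneg fun h0 => ?_
    have h1 := hφ.le_dist_coneMap (rep (up (Y u))) (rep (Y v))
    have h2 := dist_triangle_right (Q u) (hφ.coneMap (rep (Y v))) (J v)
    rw [hYJ, add_zero, ← h0] at h2
    have h3 : dist (Q u) (hφ.coneMap (rep (Y v))) = 0 := le_antisymm h2 dist_nonneg
    change _ ≤ C * dist (Q u) _ at h1
    rw [h3, mul_zero, hrepd] at h1
    have h4 : up (Y u) = Y v := hA.injective (dist_le_zero.1 h1)
    have h5 : (Y v).snd = 0 := hYb v
    rw [← h4] at h5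
    exact one_ne_zero h5
  obtain ⟨u, x, hux⟩ := exists_forall_exists_dist_le_add hiso
    (bruhatTitsAlong_coneFlat hM₂ S (φ b) hf) (coneFlat_quadrilateral hM₂ S (φ b) hf) hQ hQc hQpos
  exact exists_dist_le_add_one_of_coneFlat hM₂ hf (hQpos u x) hux hN

theorem AtBoundedDistance.exists_forall_exists_dist_le {X : Type*} [MetricSpace X] {A B : Set X}
    (h : AtBoundedDistance A B) : ∃ D : ℝ, ∀ x ∈ A, ∃ y ∈ B, dist x y ≤ D := by
  refine ⟨(Metric.hausdorffEDist A B + 1).toReal, fun x hx => ?_⟩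
  obtain ⟨y, hy, hxy⟩ := Metric.exists_edist_lt_of_hausdorffEDist_lt hx
    (ENNReal.lt_add_right h one_ne_zero)
  refine ⟨y, hy, ?_⟩
  rw [dist_edist]
  exact ENNReal.toReal_mono (ENNReal.add_ne_top.2 ⟨h, ENNReal.one_ne_top⟩) hxy.le

end QuasiIsometries

theorem corollary5p1 {M₁ M₂ : Type*} [MetricSpace M₁] [MetricSpace M₂]
    [LocallyCompactSpace M₁] [LocallyCompactSpace M₂] [CompleteSpace M₂]
    (hM₁ : IsCAT0Space M₁) (hM₂ : IsCAT0Space M₂)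
    (φ : M₁ → M₂) (hφ : ∃ C K : ℝ, IsQuasiIsometricMap C K φ)
    (k : ℕ) (hk : 1 ≤ k) (γ : Set M₁) (hγ : IsKFlat k γ)
    (S : ConeScaling) (b : M₁)
    (hF : BoundsBiLipschitzHalfFlat k (coneOfSubset S b γ)) :
    (∀ η : Set M₂, IsKFlat k η → AtBoundedDistance η (φ '' γ) →
        ¬ CompactSpace (StabilizerQuotient η)) ∨
      (∀ η : Set M₂, IsKFlat k η → AtBoundedDistance η (φ '' γ) → BoundsHalfFlat k η) := by
  obtain ⟨C, K, hφ⟩ := hφ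
  refine or_iff_not_imp_left.2 fun hper η hη hηγ => ?_
  push Not at hper
  obtain ⟨η₀, ⟨f₀, hf₀, rfl⟩, hη₀γ, hcpt⟩ := hper
  obtain ⟨f, hf, rfl⟩ := hη
  have := properSpace_of_exists_geodesic hM₂.exists_geodesic
  let o := f₀ 0
  obtain ⟨R, hR⟩ := exists_dist_le_of_compactSpace_stabilizerQuotient (Set.range f₀) o
  obtain ⟨D, hD⟩ := hη₀γ.exists_forall_exists_dist_le
  -- the half-flat will be attached directly to `η`, which need not be periodic
  obtain ⟨D', hD'⟩ : ∃ D' : ℝ, ∀ x ∈ Set.range f, ∃ y ∈ Set.range f₀, dist x y ≤ D' := by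
    refine AtBoundedDistance.exists_forall_exists_dist_le (ne_top_of_le_ne_top ?_
      (Metric.hausdorffEDist_triangle (s := Set.range f) (t := φ '' γ) (u := Set.range f₀)))
    rw [Metric.hausdorffEDist_comm (s := φ '' γ)]
    exact ENNReal.add_ne_top.2 ⟨hηγ, hη₀γ⟩
  choose p y hpy hflat using fun j : ℕ =>
    exists_dist_le_add_one_of_boundsBiLipschitzHalfFlat hM₂ hφ hF hf₀ (D := D) (fun u => by
      obtain ⟨_, ⟨a, ha, rfl⟩, hd⟩ := hD (f₀ u) (Set.mem_range_self u)
      exact ⟨a, ha, hd⟩) (N := (j : ℝ) + 1) (by positivity)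
  choose g hg hgR using fun j => hR (f₀ (y j)) (Set.mem_range_self _)
  refine hM₂.boundsHalfFlat hf (p := fun j => g j (p j)) (o := o) (C := D' + R + 1) ?_ fun u => ?_
  · refine Filter.tendsto_atTop_mono (f := fun j : ℕ => (j : ℝ) + (1 - R)) (fun j => ?_)
      (Filter.tendsto_atTop_add_const_right _ _ tendsto_natCast_atTop_atTop)
    have h1 := dist_triangle_right (g j (p j)) (g j (f₀ (y j))) o
    rw [(g j).dist_eq] at h1
    linarith [hpy j, hgR j]
  · obtain ⟨q, hq, hqd⟩ := hD' (f u) (Set.mem_range_self u)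
    filter_upwards [tendsto_natCast_atTop_atTop.eventually_ge_atTop (dist q o + R)] with j hj
    have hgj : g j '' Set.range f₀ = Set.range f₀ := hg j
    rw [← hgj] at hq
    obtain ⟨_, ⟨w, rfl⟩, rfl⟩ := hq
    have h1 : dist w (y j) ≤ j + 1 := by
      rw [← hf₀.dist_eq, ← (g j).dist_eq]
      linarith [dist_triangle_right (g j (f₀ w)) (g j (f₀ (y j))) o, hgR j]
    have h2 := hflat j w h1
    rw [← (g j).dist_eq (p j), ← (g j).dist_eq (p j)] at h2
    have h3 := dist_triangle_right (g j (p j)) (f u) (g j (f₀ w))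
    have h4 := dist_triangle_right (g j (p j)) (g j (f₀ (y j))) o
    linarith [hgR j]
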